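/- Let $\Gamma=\mathrm{SL}(2,\mathbb Z)$ and $\mathcal X=\Gamma\backslash\mathrm{SL}(2,\mathbb R)$, with the geodesic flow $\varphi_t(x)=x\begin{pmatrix}e^{t/2}&0\\0&e^{-t/2}\end{pmatrix}$, the unstable horocycle flow $h^+_s(x)=x\begin{pmatrix}1&0\\-s&1\end{pmatrix}$ and the stable horocycle flow $h^-_s(x)=x\begin{pmatrix}1&s\\0&1\end{pmatrix}$. Let $x_\infty=\Gamma\cdot 1$, let $\mathcal C=\{h^-_s(x_\infty):s\in\mathbb R\}$ be the closed stable horocycle of length one around the cusp, and let $\mathcal H=\bigcup_{t\ge 0}\varphi_t(\mathcal C)$ be the corresponding Poincaré section for $h^+$, parametrised by $\iota(s,t)=\varphi_t(h^-_s(x_\infty))$ with $(s,t)\in\Sigma=[0,1)\times[0,\infty)$. For $w\in\Sigma$ let $$\eta_{1}(w)=\inf\{r>0: h^+_{r}(\iota(w))\in\mathcal H\},\qquad \eta_{-1}(w)=\inf\{r>0: h^+_{-r}(\iota(w))\in\mathcal H\}$$ be the forward and backward return times, put $d\nu(s,t)=e^{-t}\,dt\,ds$ and $\overline\eta_1=\int_\Sigma\eta_1\,d\nu$,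 and define the hitting time density and the extreme value density by $$\Psi(r)=\frac1{\overline\eta_1}\int_\Sigma \mathbf 1\big(r<\eta_{-1}(w)\big)\,d\nu(w)\quad(r\ge 0),\qquad \rho(s)=e^{-s}\,\Psi(e^{-s})\quad(s\in\mathbb R).$$ Then: 1. $$\Psi(r)=\frac3{\pi^2}\times\begin{cases}1&\text{if } r\in[0,1),\\ -1+2r^{-1}+2r^{-1}\log r&\text{if } r\in[1,4],\\ -1+2r^{-1}+2\sqrt{\tfrac14-r^{-1}}-4r^{-1}\log\Big(\tfrac12+\sqrt{\tfrac14-r^{-1}}\Big)&\text{if } r\in[4,\infty),\end{cases}$$ and $\Psi(r)\sim\frac{6}{\pi^2}r^{-2}$ as $r\to\infty$. 2. $\frac{\pi^2}{3}\Psi$ is Hall's limiting gap distribution of the Farey sequence: for every $r\ge0$, among the gaps $y-x$ between consecutive reduced fractions in $[0,1]$ with denominators at most $N$, the proportion of those with $N^2(y-x)>r$ converges to $\frac{\pi^2}{3}\Psi(r)$ as $N\to\infty$. 3. $$\rho(s)=\frac3{\pi^2}\times\begin{cases}-e^{-s}+2+2e^{-s}\sqrt{\tfrac14-e^{s}}-4\log\Big(\tfrac12+\sqrt{\tfrac14-e^{s}}\Big)&\text{if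 } s\in(-\infty,-2\log2],\\ -e^{-s}+2-2s&\text{if } s\in[-2\log 2,0],\\ e^{-s}&\text{if } s\in[0,\infty),\end{cases}$$ and $\rho(s)\sim\frac6{\pi^2}e^{-|s|}$ as $s\to-\infty$. -/

import Mathlib

open MeasureTheory Filter Topology Asymptotics

namespace ModularHorocycle

/-- The group `SL(2, ℝ)`. -/
abbrev G : Type := Matrix.SpecialLinearGroup (Fin 2) ℝ

/-- The modular group `SL(2, ℤ)` as a subgroup of `SL(2, ℝ)`. -/
def Γ : Subgroup G := (Matrix.SpecialLinearGroup.map (n := Fin 2) (Int.castRingHom ℝ)).range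

/-- The space `Γ \ SL(2, ℝ)` of cosets `Γ g`, i.e. the unit tangent bundle of the modular
surface. -/
abbrev X : Type := Quotient (QuotientGroup.rightRel Γ)

/-- The right action `Γ g ↦ Γ g k` of `SL(2, ℝ)` on `X`. -/
def translate (x : X) (k : G) : X :=
  Quotient.map (fun g : G => g * k)
    (fun a b h => by
      have h' : b * a⁻¹ ∈ Γ := QuotientGroup.rightRel_apply.mp h
      refine QuotientGroup.rightRel_apply.mpr ?_
      simpa [mul_assoc] using h') x

/-- The matrix `diag(e^{t/2}, e^{-t/2})`. -/
noncomputable def aMat (t : ℝ) : G :=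
  ⟨!![Real.exp (t / 2), 0; 0, Real.exp (-t / 2)], by
    rw [Matrix.det_fin_two_of, mul_zero, sub_zero, ← Real.exp_add,
      show t / 2 + -t / 2 = 0 by ring, Real.exp_zero]⟩

/-- The lower triangular unipotent matrix `(1, 0; -s, 1)`. -/
def hPlusMat (s : ℝ) : G := ⟨!![1, 0; -s, 1], by simp [Matrix.det_fin_two_of]⟩

/-- The upper triangular unipotent matrix `(1, s; 0, 1)`. -/
def hMinusMat (s : ℝ) : G := ⟨!![1, s; 0, 1], by simp [Matrix.det_fin_two_of]⟩

/-- The geodesic flow `φ_t`. -/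
noncomputable def geodesicFlow (t : ℝ) (x : X) : X := translate x (aMat t)

/-- The unstable horocycle flow `h⁺_s`. -/
def horoPlus (s : ℝ) (x : X) : X := translate x (hPlusMat s)

/-- The stable horocycle flow `h⁻_s`. -/
def horoMinus (s : ℝ) (x : X) : X := translate x (hMinusMat s)

/-- The base point `Γ 1` on the closed stable horocycle of length one. -/
def basePoint : X := Quotient.mk _ (1 : G)

/-- The closed stable horocycle of length one around the cusp. -/
def cuspHorocycle : Set X := Set.range (fun s : ℝ => horoMinus s basePoint)

/-- The section `H(R)`, the union of the `φ_t (cuspHorocycle)` with `t ≥ R`. -/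
def crossSection (R : ℝ) : Set X := ⋃ t ∈ Set.Ici R, geodesicFlow t '' cuspHorocycle

/-- The parameter domain `[0,1) × [0,∞)` of the section. -/
def Sigma0 : Set (ℝ × ℝ) := Set.Ico 0 1 ×ˢ Set.Ici 0

/-- The parametrisation `ι_0 (s,t) = φ_t (h⁻_s (basePoint))` of the section `H(0)`. -/
noncomputable def iota0 (w : ℝ × ℝ) : X := geodesicFlow w.2 (horoMinus w.1 basePoint)

/-- The measure `dν(s,t) = e^{-t} dt ds` on `[0,1) × [0,∞)`. -/
noncomputable def nu : Measure (ℝ × ℝ) :=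
  (volume.restrict Sigma0).withDensity (fun w => ENNReal.ofReal (Real.exp (-w.2)))

/-- The first return time `η_1(w)` to `H(0)` of the unstable horocycle flow started at `ι_0(w)`. -/
noncomputable def returnTime (w : ℝ × ℝ) : ℝ :=
  sInf {r : ℝ | 0 < r ∧ horoPlus r (iota0 w) ∈ crossSection 0}

/-- The first backward return time `η_{-1}(w)`. -/
noncomputable def backwardReturnTime (w : ℝ × ℝ) : ℝ :=
  sInf {r : ℝ | 0 < r ∧ horoPlus (-r) (iota0 w) ∈ crossSection 0}

/-- The mean return time, the integral of `η_1` against `ν`. -/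
noncomputable def meanReturnTime : ℝ := ∫ w, returnTime w ∂nu

open Classical in
/-- The joint limit density `Ψ(r,w)` of the first hitting time and impact parameter. -/
noncomputable def jointDensity (r : ℝ) (w : ℝ × ℝ) : ℝ :=
  (1 / meanReturnTime) * (if r < backwardReturnTime w then 1 else 0)

/-- The hitting time density `Ψ(r)`. -/
noncomputable def hittingDensity (r : ℝ) : ℝ := ∫ w, jointDensity r w ∂nu

/-- The extreme value density `ρ(s) = e^{-s} Ψ(e^{-s})`. -/
noncomputable def extremeDensity (s : ℝ) : ℝ :=
  Real.exp (-s) * hittingDensity (Real.exp (-s))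

/-- The Farey fractions of level `N`: reduced fractions in `[0,1]` with denominator at most `N`. -/
def farey (N : ℕ) : Set ℚ := {x | 0 ≤ x ∧ x ≤ 1 ∧ x.den ≤ N}

/-- The pairs `(x, y)` of consecutive Farey fractions of level `N`. -/
def fareyPairs (N : ℕ) : Set (ℚ × ℚ) :=
  {p | p.1 ∈ farey N ∧ p.2 ∈ farey N ∧ p.1 < p.2 ∧ ∀ z ∈ farey N, ¬ (p.1 < z ∧ z < p.2)}

/-- The proportion of the gaps `y - x` between consecutive Farey fractions of level `N`
for which `N² (y - x) > r`. -/
noncomputable def fareyGapTail (N : ℕ) (r : ℝ) : ℝ :=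
  ({p ∈ fareyPairs N | r < (N : ℝ) ^ 2 * ((p.2 : ℝ) - (p.1 : ℝ))}.ncard : ℝ)
    / ((fareyPairs N).ncard : ℝ)

end ModularHorocycle

/-!
A point of the section is a unimodular lattice with a primitive vector of height `y ∈ (0, 1]`, and
its return is governed by the largest height `v ≤ 1` that completes this vector to a basis: the
return time is `1 / (y v)`. The pair `(y, v)` lies in the Farey triangle `y, v ≤ 1 < y + v`, and the
measure `ν` is pushed forward to twice Lebesgue measure there. Reflecting the horocycle exchanges
forward and backward times, so `Ψ(r)` is proportional to the area of the part of the triangle with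
`r y v < 1`, which is an elementary integral.

Consecutive Farey fractions with denominators `a` and `b` have gap `1 / (a b)`, and the points
`(a / N, b / N)` are the primitive lattice points of the same triangle, rescaled by `N`. Primitive
points equidistribute by Möbius inversion, so the gap distribution is given by the same areas.
-/

namespace ModularHorocycle

/-! ### Return times to the section -/

lemma coe_hMinusMat_mul_aMat (s t : ℝ) :
    ((hMinusMat s * aMat t : G) : Matrix (Fin 2) (Fin 2) ℝ) =
      !![Real.exp (t / 2), s * Real.exp (-t / 2); 0, Real.exp (-t / 2)] := by
  have h_minus : (hMinusMat s : Matrix (Fin 2) (Fin 2) ℝ) = !![1, s; 0, 1] := rfl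
  have h_geod : (aMat t : Matrix (Fin 2) (Fin 2) ℝ) =
    !![Real.exp (t / 2), 0; 0, Real.exp (-t / 2)] := rfl
  rw [Matrix.SpecialLinearGroup.coe_mul, h_minus, h_geod]
  simp

lemma exists_hMinusMat_mul_aMat_eq_iff (R : ℝ) (g : G) :
    (∃ t ≥ R, ∃ s, hMinusMat s * aMat t = g) ↔
      g 1 0 = 0 ∧ g 1 1 ∈ Set.Ioc 0 (Real.exp (-R / 2)) := by
  constructor
  · rintro ⟨t, ht, s, rfl⟩
    rw [coe_hMinusMat_mul_aMat]
    exact ⟨rfl, Real.exp_pos _, Real.exp_le_exp.2 (by linarith)⟩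
  · rintro ⟨h10, hpos, hle⟩
    have hdet : g 0 0 * g 1 1 = 1 := by
      simpa [h10] using (Matrix.det_fin_two g.1).symm.trans g.2
    have hlog : Real.exp (Real.log (g 1 1)) = g 1 1 := Real.exp_log hpos
    have hlog_le : Real.log (g 1 1) ≤ -R / 2 := (Real.log_le_iff_le_exp hpos).2 hle
    refine ⟨-2 * Real.log (g 1 1), by linarith, g 0 1 / g 1 1, Subtype.ext ?_⟩
    rw [coe_hMinusMat_mul_aMat, show -(-2 * Real.log (g 1 1)) / 2 = Real.log (g 1 1) by ring,
      show -2 * Real.log (g 1 1) / 2 = -Real.log (g 1 1) by ring, Real.exp_neg, hlog,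
      div_mul_cancel₀ _ hpos.ne', inv_eq_of_mul_eq_one_left hdet, ← h10]
    exact (Matrix.eta_fin_two _).symm

lemma mk_mem_crossSection_iff (R : ℝ) (g : G) :
    (Quotient.mk _ g : X) ∈ crossSection R ↔
      ∃ γ : Matrix.SpecialLinearGroup (Fin 2) ℤ, ∃ t ≥ R, ∃ s,
        hMinusMat s * aMat t = Matrix.SpecialLinearGroup.map (Int.castRingHom ℝ) γ * g := by
  have h_coset (s t : ℝ) : geodesicFlow t (horoMinus s basePoint) = Quotient.mk _ g ↔
      ∃ γ : Matrix.SpecialLinearGroup (Fin 2) ℤ,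
        hMinusMat s * aMat t = Matrix.SpecialLinearGroup.map (Int.castRingHom ℝ) γ * g := by
    change (Quotient.mk _ (1 * hMinusMat s * aMat t) : X) = _ ↔ _
    rw [eq_comm, Quotient.eq, one_mul]
    rw [QuotientGroup.rightRel_apply, Γ, MonoidHom.mem_range]
    exact exists_congr fun γ => by rw [eq_mul_inv_iff_mul_eq, eq_comm]
  simp only [crossSection, cuspHorocycle, Set.mem_iUnion, Set.mem_Ici, Set.mem_image,
    Set.mem_range, exists_exists_eq_and, exists_prop, h_coset]
  exact ⟨fun ⟨t, ht, s, γ, h⟩ => ⟨γ, t, ht, s, h⟩, fun ⟨γ, t, ht, s, h⟩ => ⟨t, ht, s, γ, h⟩⟩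

lemma mk_mem_crossSection_iff_exists_isCoprime (R : ℝ) (g : G) :
    (Quotient.mk _ g : X) ∈ crossSection R ↔
      ∃ c d : ℤ, IsCoprime c d ∧ c * g 0 0 + d * g 1 0 = 0 ∧
        c * g 0 1 + d * g 1 1 ∈ Set.Ioc 0 (Real.exp (-R / 2)) := by
  have h_row (γ : Matrix.SpecialLinearGroup (Fin 2) ℤ) (j : Fin 2) :
      (Matrix.SpecialLinearGroup.map (Int.castRingHom ℝ) γ * g) 1 j =
        γ 1 0 * g 0 j + γ 1 1 * g 1 j := by
    simp [Matrix.mul_apply, Fin.sum_univ_two]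
  simp only [mk_mem_crossSection_iff, exists_hMinusMat_mul_aMat_eq_iff, h_row]
  constructor
  · rintro ⟨γ, h⟩
    exact ⟨γ 1 0, γ 1 1, ModularGroup.bottom_row_coprime γ, h⟩
  · rintro ⟨c, d, hcd, h⟩
    obtain ⟨γ, -, hγ⟩ := ModularGroup.bottom_row_surj (show ![c, d] ∈ {cd | _} from hcd)
    have hc : γ 1 0 = c := congrFun hγ 0
    have hd : γ 1 1 = d := congrFun hγ 1
    exact ⟨γ, by rwa [hc, hd]⟩

lemma horoPlus_iota0_mem_crossSection_iff (R r s t : ℝ) :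
    horoPlus r (iota0 (s, t)) ∈ crossSection R ↔
      ∃ c d : ℤ, IsCoprime c d ∧
        c / Real.exp (-t / 2) = r * ((c * s + d) * Real.exp (-t / 2)) ∧
        (c * s + d) * Real.exp (-t / 2) ∈ Set.Ioc 0 (Real.exp (-R / 2)) := by
  have h_plus : (hPlusMat r : Matrix (Fin 2) (Fin 2) ℝ) = !![1, 0; -r, 1] := rfl
  have h_exp : Real.exp (t / 2) = (Real.exp (-t / 2))⁻¹ := by rw [← Real.exp_neg]; ring_nf
  change (Quotient.mk _ (1 * hMinusMat s * aMat t * hPlusMat r) : X) ∈ _ ↔ _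
  rw [mk_mem_crossSection_iff_exists_isCoprime, one_mul, Matrix.SpecialLinearGroup.coe_mul,
    coe_hMinusMat_mul_aMat, h_plus, h_exp]
  simp only [Matrix.mul_apply, Fin.sum_univ_two, Matrix.of_apply, Matrix.cons_val',
    Matrix.cons_val_zero, Matrix.cons_val_one, Matrix.cons_val_fin_one]
  refine exists_congr fun c => exists_congr fun d => and_congr_right fun _ => and_congr ?_ ?_
  · rw [← sub_eq_zero (a := (c : ℝ) / _)]
    ring_nf
  · ring_nf

lemma backwardReturnTime_eq_returnTime_neg (s t : ℝ) :
    backwardReturnTime (s, t) = returnTime (-s, t) := by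
  rw [backwardReturnTime, returnTime]
  congr 1
  ext r
  simp only [Set.mem_ofPred_eq, horoPlus_iota0_mem_crossSection_iff]
  refine and_congr_right fun _ => (Equiv.neg ℤ).exists_congr fun c => exists_congr fun d => ?_
  simp only [Equiv.neg_apply, Int.cast_neg, IsCoprime.neg_left_iff, neg_mul_neg,
    neg_div (Real.exp _), neg_eq_iff_eq_neg (a := (c : ℝ) / _), ← neg_mul]

/-- The representative of `s * y` modulo `y` in `(1 - y, 1]`: in the lattice spanned by `(0, y)` and
`(1 / y, s * y)`, it is the largest height at most `1` of a vector of abscissa `1 / y`. -/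
noncomputable def nextHeight (s y : ℝ) : ℝ := 1 - y * Int.fract (1 / y - s)

lemma nextHeight_mem_Ioc (s : ℝ) {y : ℝ} (hy : 0 < y) : nextHeight s y ∈ Set.Ioc (1 - y) 1 := by
  have h_nonneg := mul_nonneg hy.le (Int.fract_nonneg (1 / y - s))
  have h_lt := mul_lt_mul_of_pos_left (Int.fract_lt_one (1 / y - s)) hy
  constructor <;> unfold nextHeight <;> linarith

lemma nextHeight_pos (s : ℝ) {y : ℝ} (hy : y ∈ Set.Ioc 0 1) : 0 < nextHeight s y := by
  linarith [(nextHeight_mem_Ioc s hy.1).1, hy.2]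

lemma nextHeight_eq_add_floor_mul (s : ℝ) {y : ℝ} (hy : y ≠ 0) :
    nextHeight s y = (s + ⌊1 / y - s⌋) * y := by
  have h_cancel : y * (1 / y) = 1 := by field_simp
  unfold nextHeight Int.fract
  linear_combination -h_cancel

lemma nextHeight_fract (s y : ℝ) : nextHeight (Int.fract s) y = nextHeight s y := by
  have h_shift : 1 / y - Int.fract s = 1 / y - s + ⌊s⌋ := by rw [Int.fract]; ring
  rw [nextHeight, nextHeight, h_shift, Int.fract_add_intCast]

lemma le_mul_nextHeight (s : ℝ) {y : ℝ} (hy : y ∈ Set.Ioc 0 1) {c d : ℤ} (hc : 0 < c)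
    (h : (c * s + d) * y ≤ 1) : (c * s + d) * y ≤ c * nextHeight s y := by
  set e : ℤ := ⌊1 / y - s⌋
  have hc_one : (1 : ℝ) ≤ c := by exact_mod_cast hc
  have h_split : (c * s + d) * y = c * nextHeight s y + ((d - c * e : ℤ) : ℝ) * y := by
    rw [nextHeight_eq_add_floor_mul s hy.1.ne']
    push_cast
    ring
  rcases le_or_gt (d - c * e) 0 with he | he
  · have : ((d - c * e : ℤ) : ℝ) ≤ 0 := by exact_mod_cast he
    nlinarith [hy.1]
  · have : (1 : ℝ) ≤ ((d - c * e : ℤ) : ℝ) := by exact_mod_cast he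
    linarith [(nextHeight_mem_Ioc s hy.1).1, le_mul_of_one_le_left hy.1.le this,
      le_mul_of_one_le_left (nextHeight_pos s hy).le hc_one]

lemma isLeast_returnTime (s : ℝ) {t : ℝ} (ht : 0 ≤ t) :
    IsLeast {r : ℝ | 0 < r ∧ horoPlus r (iota0 (s, t)) ∈ crossSection 0}
      (1 / (Real.exp (-t / 2) * nextHeight s (Real.exp (-t / 2)))) := by
  simp only [horoPlus_iota0_mem_crossSection_iff, neg_zero, zero_div, Real.exp_zero]
  have hy : Real.exp (-t / 2) ∈ Set.Ioc 0 1 :=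
    ⟨Real.exp_pos _, Real.exp_le_one_iff.2 (by linarith)⟩
  generalize Real.exp (-t / 2) = y at hy
  have hv := nextHeight_pos s hy
  have hy_pos := hy.1
  refine ⟨⟨by positivity, 1, ⌊1 / y - s⌋, isCoprime_one_left, ?_⟩, ?_⟩
  · rw [Int.cast_one, one_mul, ← nextHeight_eq_add_floor_mul s hy.1.ne']
    exact ⟨by field_simp, hv, (nextHeight_mem_Ioc s hy.1).2⟩
  · rintro r ⟨hr, c, d, -, h_abscissa, h_pos, h_le⟩
    have hc : 0 < c := by
      have : 0 < (c : ℝ) / y := h_abscissa ▸ mul_pos hr h_pos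
      exact_mod_cast (div_pos_iff_of_pos_right hy.1).1 this
    have h_height := le_mul_nextHeight s hy hc h_le
    rw [div_eq_iff hy.1.ne'] at h_abscissa
    rw [div_le_iff₀ (by positivity)]
    nlinarith

lemma returnTime_eq (s : ℝ) {t : ℝ} (ht : 0 ≤ t) :
    returnTime (s, t) = 1 / (Real.exp (-t / 2) * nextHeight s (Real.exp (-t / 2))) :=
  (isLeast_returnTime s ht).csInf_eq

lemma backwardReturnTime_eq_returnTime_fract_neg (s : ℝ) {t : ℝ} (ht : 0 ≤ t) :
    backwardReturnTime (s, t) = returnTime (Int.fract (-s), t) := by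
  rw [backwardReturnTime_eq_returnTime_neg, returnTime_eq _ ht, returnTime_eq _ ht,
    nextHeight_fract]

/-! ### The law of the heights of two consecutive lattice vectors -/

lemma measurePreserving_fract_sub (a : ℝ) :
    MeasurePreserving (fun s => Int.fract (a - s)) (volume.restrict (Set.Ico 0 1))
      (volume.restrict (Set.Ico 0 1)) := by
  have h_mk : MeasurePreserving ((↑) : ℝ → UnitAddCircle) (volume.restrict (Set.Ico 0 1)) := by
    simpa [restrict_Ico_eq_restrict_Ioc] using UnitAddCircle.measurePreserving_mk 0
  let frac (b : UnitAddCircle) : ℝ := AddCircle.equivIco 1 0 b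
  have h_frac_mk (x : ℝ) : frac x = Int.fract x := by
    simp [frac, AddCircle.coe_equivIco_mk_apply]
  have h_meas : Measurable frac := (AddCircle.measurableEquivIco 1 0).measurable.subtype_val
  have h_frac : MeasurePreserving frac volume (volume.restrict (Set.Ico 0 1)) := by
    refine ⟨h_meas, ?_⟩
    rw [← h_mk.map_eq, Measure.map_map h_meas h_mk.measurable]
    refine (Measure.map_congr ?_).trans Measure.map_id
    filter_upwards [ae_restrict_mem measurableSet_Ico] with x hx
    exact (h_frac_mk x).trans (Int.fract_eq_self.2 hx)
  convert! h_frac.comp ((Measure.measurePreserving_sub_left volume (a : UnitAddCircle)).comp h_mk)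
    using 2 with s
  exact (h_frac_mk (a - s)).symm

lemma setLIntegral_one_sub_mul {y : ℝ} (hy : 0 < y) (f : ℝ → ENNReal) :
    ENNReal.ofReal y * ∫⁻ u in Set.Ico 0 1, f (1 - y * u) = ∫⁻ v in Set.Ioc (1 - y) 1, f v := by
  have h_image : (fun u : ℝ => 1 - y * u) '' Set.Ico 0 1 = Set.Ioc (1 - y) 1 := by
    have h_comp : (fun u : ℝ => 1 - y * u) = (1 - ·) ∘ (y * ·) := rfl
    rw [h_comp, Set.image_comp, Set.image_mul_left_Ico hy, Set.image_const_sub_Ico]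
    simp
  have h_inj : Set.InjOn (fun u : ℝ => 1 - y * u) (Set.Ico 0 1) := fun _ _ _ _ h =>
    mul_left_cancel₀ hy.ne' (sub_right_injective h)
  have h_deriv : ∀ u ∈ Set.Ico (0 : ℝ) 1,
      HasDerivWithinAt (fun u : ℝ => 1 - y * u) (-y) (Set.Ico 0 1) u := fun u _ => by
    simpa using (((hasDerivAt_id u).const_mul y).const_sub 1).hasDerivWithinAt
  rw [← h_image, lintegral_image_eq_lintegral_abs_deriv_mul measurableSet_Ico h_deriv h_inj,
    abs_neg, abs_of_pos hy, lintegral_const_mul' _ _ ENNReal.ofReal_ne_top]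

lemma setLIntegral_nextHeight {y : ℝ} (hy : 0 < y) {f : ℝ → ENNReal} (hf : Measurable f) :
    ENNReal.ofReal y * ∫⁻ s in Set.Ico 0 1, f (nextHeight s y) =
      ∫⁻ v in Set.Ioc (1 - y) 1, f v := by
  rw [← setLIntegral_one_sub_mul hy, ← (measurePreserving_fract_sub (1 / y)).lintegral_comp
    (f := fun u => f (1 - y * u)) (by fun_prop)]
  rfl

lemma setLIntegral_exp_neg_half (f : ℝ → ENNReal) :
    ∫⁻ t in Set.Ici 0, ENNReal.ofReal (Real.exp (-t / 2) / 2) * f (Real.exp (-t / 2)) =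
      ∫⁻ y in Set.Ioc 0 1, f y := by
  have h_image : (fun t : ℝ => Real.exp (-t / 2)) '' Set.Ici 0 = Set.Ioc 0 1 := by
    ext y
    refine ⟨?_, fun ⟨h_pos, h_le⟩ => ⟨-2 * Real.log y, ?_, ?_⟩⟩
    · rintro ⟨t, ht : 0 ≤ t, rfl⟩
      exact ⟨Real.exp_pos _, Real.exp_le_one_iff.2 (by linarith)⟩
    · exact mul_nonneg_of_nonpos_of_nonpos (by norm_num) (Real.log_nonpos h_pos.le h_le)
    · change Real.exp (-(-2 * Real.log y) / 2) = y
      rw [show -(-2 * Real.log y) / 2 = Real.log y by ring, Real.exp_log h_pos]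
  have h_inj : Set.InjOn (fun t : ℝ => Real.exp (-t / 2)) (Set.Ici 0) := fun _ _ _ _ h => by
    linarith [Real.exp_injective h]
  have h_deriv : ∀ t ∈ Set.Ici (0 : ℝ), HasDerivWithinAt (fun t : ℝ => Real.exp (-t / 2))
      (Real.exp (-t / 2) * (-1 / 2)) (Set.Ici 0) t := fun t _ =>
    ((hasDerivAt_neg t).div_const 2).exp.hasDerivWithinAt
  rw [← h_image, lintegral_image_eq_lintegral_abs_deriv_mul measurableSet_Ici h_deriv h_inj]
  refine lintegral_congr fun t => ?_
  rw [abs_mul, Real.abs_exp, show |(-1 / 2 : ℝ)| = 1 / 2 by norm_num, mul_one_div]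

/-- The heights of two consecutive vectors, with abscissae `0` and `1 / y`, of the lattice attached
to the point `w` of the section. -/
noncomputable def sectionHeights (w : ℝ × ℝ) : ℝ × ℝ :=
  (Real.exp (-w.2 / 2), nextHeight w.1 (Real.exp (-w.2 / 2)))

/-- The triangle swept out by `(a / N, b / N)`, for `a` and `b` the denominators of consecutive
Farey fractions of level `N`. -/
def fareyTriangle : Set (ℝ × ℝ) := {p | p.1 ∈ Set.Ioc 0 1 ∧ p.2 ∈ Set.Ioc (1 - p.1) 1}

lemma sectionHeights_mem_fareyTriangle {w : ℝ × ℝ} (hw : w ∈ Sigma0) :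
    sectionHeights w ∈ fareyTriangle :=
  ⟨⟨Real.exp_pos _, Real.exp_le_one_iff.2 (by linarith [Set.mem_Ici.1 hw.2])⟩,
    nextHeight_mem_Ioc w.1 (Real.exp_pos _)⟩

lemma pos_of_mem_fareyTriangle {p : ℝ × ℝ} (hp : p ∈ fareyTriangle) : 0 < p.1 ∧ 0 < p.2 :=
  ⟨hp.1.1, (sub_nonneg.2 hp.1.2).trans_lt hp.2.1⟩

lemma returnTime_eq_sectionHeights {w : ℝ × ℝ} (hw : w ∈ Sigma0) :
    returnTime w = 1 / ((sectionHeights w).1 * (sectionHeights w).2) :=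
  returnTime_eq w.1 hw.2

lemma measurable_sectionHeights : Measurable sectionHeights := by
  unfold sectionHeights nextHeight
  fun_prop

lemma measurableSet_fareyTriangle : MeasurableSet fareyTriangle := by
  have h_fst : Measurable (Prod.fst : ℝ × ℝ → ℝ) := measurable_fst
  have h_snd : Measurable (Prod.snd : ℝ × ℝ → ℝ) := measurable_snd
  exact (h_fst measurableSet_Ioc).inter <|
    (measurableSet_lt (h_fst.const_sub 1) h_snd).inter (measurableSet_le h_snd measurable_const)

lemma measurableSet_Sigma0 : MeasurableSet Sigma0 := measurableSet_Ico.prod measurableSet_Ici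

lemma ae_nu_mem_Sigma0 : ∀ᵐ w ∂nu, w ∈ Sigma0 :=
  (withDensity_absolutelyContinuous _ _).ae_le (ae_restrict_mem measurableSet_Sigma0)

lemma lintegral_nu {f : ℝ × ℝ → ENNReal} (hf : Measurable f) :
    ∫⁻ w, f w ∂nu =
      ∫⁻ t in Set.Ici 0, ENNReal.ofReal (Real.exp (-t)) * ∫⁻ s in Set.Ico 0 1, f (s, t) := by
  have h_density : Measurable fun w : ℝ × ℝ => ENNReal.ofReal (Real.exp (-w.2)) := by fun_prop
  rw [nu, lintegral_withDensity_eq_lintegral_mul _ h_density hf, Sigma0, Measure.volume_eq_prod,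
    ← Measure.prod_restrict, lintegral_prod_symm _ (h_density.mul hf).aemeasurable]
  refine lintegral_congr fun t => ?_
  simp only [Pi.mul_apply]
  exact lintegral_const_mul' _ _ ENNReal.ofReal_ne_top

lemma setLIntegral_fareyTriangle {f : ℝ × ℝ → ENNReal} (hf : Measurable f) :
    ∫⁻ p in fareyTriangle, f p = ∫⁻ y in Set.Ioc 0 1, ∫⁻ v in Set.Ioc (1 - y) 1, f (y, v) := by
  have h_fiber (y v : ℝ) : fareyTriangle.indicator f (y, v) =
      (Set.Ioc 0 1).indicator (fun y => (Set.Ioc (1 - y) 1).indicator (fun v => f (y, v)) v) y := by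
    classical
    simp only [Set.indicator_apply, fareyTriangle, Set.mem_ofPred_eq, ite_and]
  rw [← lintegral_indicator measurableSet_fareyTriangle, Measure.volume_eq_prod,
    lintegral_prod _ (hf.indicator measurableSet_fareyTriangle).aemeasurable,
    ← lintegral_indicator measurableSet_Ioc]
  refine lintegral_congr fun y => ?_
  simp only [h_fiber]
  by_cases hy : y ∈ Set.Ioc 0 1
  · simp only [Set.indicator_of_mem hy, lintegral_indicator measurableSet_Ioc]
  · simp only [Set.indicator_of_notMem hy, lintegral_zero]

lemma measurePreserving_sectionHeights :
    MeasurePreserving sectionHeights nu ((2 : ENNReal) • volume.restrict fareyTriangle) := by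
  refine ⟨measurable_sectionHeights, Measure.ext_of_lintegral _ fun f hf => ?_⟩
  rw [lintegral_map hf measurable_sectionHeights,
    lintegral_nu (f := fun w => f (sectionHeights w)) (hf.comp measurable_sectionHeights),
    lintegral_smul_measure, setLIntegral_fareyTriangle hf, smul_eq_mul,
    ← lintegral_const_mul' _ _ ENNReal.ofNat_ne_top, ← setLIntegral_exp_neg_half]
  refine lintegral_congr fun t => ?_
  have h_exp : ENNReal.ofReal (Real.exp (-t)) =
      ENNReal.ofReal (Real.exp (-t / 2) / 2) * 2 * ENNReal.ofReal (Real.exp (-t / 2)) := by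
    rw [← ENNReal.ofReal_ofNat, ← ENNReal.ofReal_mul (by positivity),
      ← ENNReal.ofReal_mul (by positivity), div_mul_cancel₀ _ two_ne_zero, ← Real.exp_add,
      add_halves]
  rw [h_exp, mul_assoc, mul_assoc,
    ← setLIntegral_nextHeight (Real.exp_pos _) (f := fun v => f (_, v)) (by fun_prop)]
  rfl

lemma measurePreserving_fract_neg_nu :
    MeasurePreserving (fun w : ℝ × ℝ => (Int.fract (-w.1), w.2)) nu nu := by
  have h_meas : Measurable fun w : ℝ × ℝ => (Int.fract (-w.1), w.2) := by fun_prop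
  refine ⟨h_meas, Measure.ext_of_lintegral _ fun f hf => ?_⟩
  rw [lintegral_map hf h_meas, lintegral_nu (f := fun w => f (Int.fract (-w.1), w.2)) (by fun_prop),
    lintegral_nu hf]
  refine lintegral_congr fun t => ?_
  rw [← (measurePreserving_fract_sub 0).lintegral_comp (f := fun s => f (s, t)) (by fun_prop)]
  simp only [zero_sub]

/-- The heights attached to the image of `w` under the reflection `s ↦ -s` of the section, which
reverses the unstable horocycle flow. -/
noncomputable def backwardHeights (w : ℝ × ℝ) : ℝ × ℝ := sectionHeights (Int.fract (-w.1), w.2)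

lemma measurePreserving_backwardHeights :
    MeasurePreserving backwardHeights nu ((2 : ENNReal) • volume.restrict fareyTriangle) :=
  measurePreserving_sectionHeights.comp measurePreserving_fract_neg_nu

lemma backwardHeights_mem_fareyTriangle {w : ℝ × ℝ} (hw : w ∈ Sigma0) :
    backwardHeights w ∈ fareyTriangle :=
  sectionHeights_mem_fareyTriangle ⟨⟨Int.fract_nonneg _, Int.fract_lt_one _⟩, hw.2⟩

lemma backwardReturnTime_eq_backwardHeights {w : ℝ × ℝ} (hw : w ∈ Sigma0) :
    backwardReturnTime w = 1 / ((backwardHeights w).1 * (backwardHeights w).2) :=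
  (backwardReturnTime_eq_returnTime_fract_neg w.1 hw.2).trans (returnTime_eq _ hw.2)

/-! ### The mean return time -/

lemma setLIntegral_one_div_mul {y : ℝ} (hy : y ∈ Set.Ioo (0 : ℝ) 1) :
    ∫⁻ v in Set.Ioc (1 - y) 1, ENNReal.ofReal (1 / (y * v)) =
      ENNReal.ofReal (-Real.log (1 - y) / y) := by
  have h_lower : 0 < 1 - y := sub_pos.2 hy.2
  have h_le : 1 - y ≤ 1 := sub_le_self 1 hy.1.le
  have h_pos : ∀ v ∈ Set.Icc (1 - y) 1, 0 < y * v := fun v hv =>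
    mul_pos hy.1 (h_lower.trans_le hv.1)
  have h_integrable : IntegrableOn (fun v => 1 / (y * v)) (Set.Ioc (1 - y) 1) :=
    (ContinuousOn.integrableOn_Icc (continuousOn_const.div (by fun_prop)
      fun v hv => (h_pos v hv).ne')).mono_set Set.Ioc_subset_Icc_self
  rw [← ofReal_integral_eq_lintegral_ofReal h_integrable
    ((ae_restrict_mem measurableSet_Ioc).mono fun v hv =>
      (one_div_pos.2 (h_pos v (Set.Ioc_subset_Icc_self hv))).le),
    ← intervalIntegral.integral_of_le h_le]
  simp_rw [one_div, mul_inv]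
  rw [intervalIntegral.integral_const_mul, integral_inv_of_pos h_lower one_pos, one_div,
    Real.log_inv, inv_mul_eq_div]

lemma hasSum_neg_log_one_sub_div {y : ℝ} (hy : y ∈ Set.Ioo (0 : ℝ) 1) :
    HasSum (fun n : ℕ => y ^ n / (n + 1)) (-Real.log (1 - y) / y) := by
  have h_abs : |y| < 1 := by rw [abs_of_pos hy.1]; exact hy.2
  convert! (Real.hasSum_pow_div_log_of_abs_lt_one h_abs).div_const y using 2 with n
  have := hy.1.ne'
  field_simp
  ring

lemma setLIntegral_pow_div (n : ℕ) :
    ∫⁻ y in Set.Ioc (0 : ℝ) 1, ENNReal.ofReal (y ^ n / (n + 1)) =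
      ENNReal.ofReal (1 / ((n + 1 : ℕ) : ℝ) ^ 2) := by
  have h_integrable : IntegrableOn (fun y : ℝ => y ^ n / (n + 1)) (Set.Ioc 0 1) :=
    (Continuous.integrableOn_Icc (by fun_prop)).mono_set Set.Ioc_subset_Icc_self
  rw [← ofReal_integral_eq_lintegral_ofReal h_integrable
    ((ae_restrict_mem measurableSet_Ioc).mono fun y hy =>
      div_nonneg (pow_nonneg hy.1.le n) n.cast_add_one_pos.le),
    ← intervalIntegral.integral_of_le zero_le_one, intervalIntegral.integral_div, integral_pow]
  congr 1
  push_cast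
  field_simp
  simp

lemma setLIntegral_fareyTriangle_one_div_mul :
    ∫⁻ p in fareyTriangle, ENNReal.ofReal (1 / (p.1 * p.2)) = ENNReal.ofReal (Real.pi ^ 2 / 6) := by
  have h_zeta : HasSum (fun n : ℕ => 1 / ((n + 1 : ℕ) : ℝ) ^ 2) (Real.pi ^ 2 / 6) := by
    simpa using (hasSum_nat_add_iff' 1).2 hasSum_zeta_two
  have h_series : ∀ y ∈ Set.Ioo (0 : ℝ) 1,
      ∫⁻ v in Set.Ioc (1 - y) 1, ENNReal.ofReal (1 / (y * v)) =
        ∑' n : ℕ, ENNReal.ofReal (y ^ n / (n + 1)) := fun y hy => by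
    have h_log := hasSum_neg_log_one_sub_div hy
    rw [setLIntegral_one_div_mul hy, ← h_log.tsum_eq, ENNReal.ofReal_tsum_of_nonneg
      (fun n => div_nonneg (pow_nonneg hy.1.le n) n.cast_add_one_pos.le) h_log.summable]
  rw [setLIntegral_fareyTriangle (by fun_prop), ← restrict_Ioo_eq_restrict_Ioc,
    setLIntegral_congr_fun measurableSet_Ioo h_series, restrict_Ioo_eq_restrict_Ioc,
    lintegral_tsum fun n => by fun_prop]
  simp_rw [setLIntegral_pow_div]
  rw [← ENNReal.ofReal_tsum_of_nonneg (fun n => by positivity) h_zeta.summable, h_zeta.tsum_eq]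

lemma meanReturnTime_eq : meanReturnTime = Real.pi ^ 2 / 3 := by
  have h_ae : returnTime =ᵐ[nu] fun w => 1 / ((sectionHeights w).1 * (sectionHeights w).2) :=
    ae_nu_mem_Sigma0.mono fun w hw => returnTime_eq_sectionHeights hw
  have h_nonneg : ∀ᵐ p ∂(2 : ENNReal) • volume.restrict fareyTriangle,
      0 ≤ 1 / (p.1 * p.2) := by
    refine Measure.ae_smul_measure ?_ _
    filter_upwards [ae_restrict_mem measurableSet_fareyTriangle] with p hp
    have := pos_of_mem_fareyTriangle hp
    exact one_div_nonneg.2 (mul_pos this.1 this.2).le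
  have h_map := integral_map measurable_sectionHeights.aemeasurable (μ := nu)
    (f := fun p => 1 / (p.1 * p.2)) (Measurable.aestronglyMeasurable (by fun_prop))
  rw [meanReturnTime, integral_congr_ae h_ae, ← h_map, measurePreserving_sectionHeights.map_eq,
    integral_eq_lintegral_of_nonneg_ae h_nonneg
      (Measurable.aestronglyMeasurable (by fun_prop)), lintegral_smul_measure,
    setLIntegral_fareyTriangle_one_div_mul, smul_eq_mul, ENNReal.toReal_mul,
    ENNReal.toReal_ofReal (by positivity), ENNReal.toReal_ofNat]
  ring

/-! ### The hitting time density as an area -/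

/-- The part of the Farey triangle lying strictly below the hyperbola `r * y * v = 1`. -/
def cutTriangle (r : ℝ) : Set (ℝ × ℝ) := {p ∈ fareyTriangle | r * (p.1 * p.2) < 1}

/-- The tail of Hall's distribution, the limiting proportion of the gaps between consecutive Farey
fractions of level `N` that exceed `r / N ^ 2`, encoded as the normalised area of the cut
triangle. -/
noncomputable def hallTail (r : ℝ) : ℝ := 2 * volume.real (cutTriangle r)

lemma cutTriangle_subset_fareyTriangle (r : ℝ) : cutTriangle r ⊆ fareyTriangle :=
  Set.sep_subset _ _

lemma measurableSet_cutTriangle (r : ℝ) : MeasurableSet (cutTriangle r) :=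
  measurableSet_fareyTriangle.inter <| measurableSet_lt
    ((measurable_fst.mul measurable_snd).const_mul r) measurable_const

lemma lt_backwardReturnTime_iff (r : ℝ) {w : ℝ × ℝ} (hw : w ∈ Sigma0) :
    r < backwardReturnTime w ↔ backwardHeights w ∈ cutTriangle r := by
  have h_mem := backwardHeights_mem_fareyTriangle hw
  have h_pos := pos_of_mem_fareyTriangle h_mem
  rw [backwardReturnTime_eq_backwardHeights hw, lt_div_iff₀ (mul_pos h_pos.1 h_pos.2)]
  exact (and_iff_right h_mem).symm

lemma hittingDensity_eq (r : ℝ) : hittingDensity r = 3 / Real.pi ^ 2 * hallTail r := by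
  have h_ae : jointDensity r =ᵐ[nu] fun w =>
      1 / meanReturnTime * (backwardHeights ⁻¹' cutTriangle r).indicator 1 w := by
    classical
    filter_upwards [ae_nu_mem_Sigma0] with w hw
    simp only [jointDensity, lt_backwardReturnTime_iff r hw, Set.indicator_apply, Set.mem_preimage,
      Pi.one_apply]
  have h_meas := measurableSet_cutTriangle r
  rw [hittingDensity, integral_congr_ae h_ae, integral_const_mul, integral_indicator_one
    (measurePreserving_backwardHeights.measurable h_meas),
    measurePreserving_backwardHeights.measureReal_preimage h_meas.nullMeasurableSet,
    measureReal_ennreal_smul_apply, measureReal_restrict_apply h_meas,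
    Set.inter_eq_left.2 (cutTriangle_subset_fareyTriangle r), meanReturnTime_eq, one_div_div,
    ENNReal.toReal_ofNat, hallTail]

/-- The upper boundary of the region `{(y, v) : v ≤ 1, r * y * v ≤ 1}`. -/
noncomputable def upperHeight (r y : ℝ) : ℝ := 1 / max 1 (r * y)

/-- The upper boundary of the region `{(y, v) : y + v ≤ 1, r * y * v ≤ 1}`. -/
noncomputable def lowerHeight (r y : ℝ) : ℝ := min (1 - y) (upperHeight r y)

lemma upperHeight_pos (r y : ℝ) : 0 < upperHeight r y :=
  one_div_pos.2 (zero_lt_one.trans_le (le_max_left _ _))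

lemma lowerHeight_le_upperHeight (r y : ℝ) : lowerHeight r y ≤ upperHeight r y := min_le_right _ _

lemma continuous_upperHeight (r : ℝ) : Continuous (upperHeight r) :=
  continuous_const.div₀ (by fun_prop) fun _ => (zero_lt_one.trans_le (le_max_left _ _)).ne'

lemma continuous_lowerHeight (r : ℝ) : Continuous (lowerHeight r) :=
  Continuous.min (by fun_prop) (continuous_upperHeight r)

lemma lt_upperHeight_iff {r y v : ℝ} (hv : 0 < v) :
    v < upperHeight r y ↔ v < 1 ∧ r * (y * v) < 1 := by
  rw [upperHeight, lt_div_iff₀ (zero_lt_one.trans_le (le_max_left _ _)),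
    mul_max_of_nonneg _ _ hv.le, max_lt_iff, mul_one, mul_comm v, mul_assoc]

lemma le_upperHeight_iff {r y v : ℝ} (hv : 0 < v) :
    v ≤ upperHeight r y ↔ v ≤ 1 ∧ r * (y * v) ≤ 1 := by
  rw [upperHeight, le_div_iff₀ (zero_lt_one.trans_le (le_max_left _ _)),
    mul_max_of_nonneg _ _ hv.le, max_le_iff, mul_one, mul_comm v, mul_assoc]

lemma upperHeight_of_le {r y : ℝ} (h : r * y ≤ 1) : upperHeight r y = 1 := by
  rw [upperHeight, max_eq_left h, div_one]

lemma upperHeight_of_ge {r y : ℝ} (h : 1 ≤ r * y) : upperHeight r y = r⁻¹ * y⁻¹ := by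
  rw [upperHeight, max_eq_right h, one_div, mul_inv]

lemma lowerHeight_of_le {r y : ℝ} (hy : 0 ≤ y) (h : r * (y * (1 - y)) ≤ 1) :
    lowerHeight r y = 1 - y := by
  rcases le_or_gt (1 - y) 0 with h_nonpos | h_pos
  · exact min_eq_left (h_nonpos.trans (upperHeight_pos r y).le)
  · exact min_eq_left ((le_upperHeight_iff h_pos).2 ⟨by linarith, h⟩)

lemma lowerHeight_of_ge {r y : ℝ} (hr : 0 ≤ r) (h : 1 ≤ r * (y * (1 - y))) :
    lowerHeight r y = r⁻¹ * y⁻¹ := by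
  have h_one_le : 1 ≤ r * y := by nlinarith [mul_nonneg hr (mul_self_nonneg y)]
  rw [lowerHeight, upperHeight_of_ge h_one_le, min_eq_right]
  rw [← mul_inv, inv_eq_one_div, div_le_iff₀ (by linarith)]
  linarith

lemma volume_fiber_cutTriangle {r y : ℝ} (hy : y ∈ Set.Ioc 0 1) :
    volume (Prod.mk y ⁻¹' cutTriangle r) = ENNReal.ofReal (upperHeight r y - lowerHeight r y) := by
  have h_nonneg : 0 ≤ 1 - y := sub_nonneg.2 hy.2
  have h_length : ENNReal.ofReal (upperHeight r y - lowerHeight r y) =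
      ENNReal.ofReal (upperHeight r y - (1 - y)) := by
    rcases le_total (1 - y) (upperHeight r y) with h | h
    · rw [lowerHeight, min_eq_left h]
    · rw [lowerHeight, min_eq_right h, sub_self, ENNReal.ofReal_zero,
        ENNReal.ofReal_of_nonpos (sub_nonpos.2 h)]
  rw [h_length]
  refine le_antisymm ?_ ?_
  · rw [← Real.volume_Ioc]
    refine measure_mono fun v ⟨⟨_, h_gt, h_le⟩, h_lt⟩ => ⟨h_gt, ?_⟩
    exact (le_upperHeight_iff (h_nonneg.trans_lt h_gt)).2 ⟨h_le, le_of_lt h_lt⟩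
  · rw [← Real.volume_Ioo]
    refine measure_mono fun v ⟨h_gt, h_lt⟩ => ?_
    have h := (lt_upperHeight_iff (h_nonneg.trans_lt h_gt)).1 h_lt
    exact ⟨⟨hy, h_gt, h.1.le⟩, h.2⟩

lemma hallTail_eq_integral (r : ℝ) :
    hallTail r =
      2 * ((∫ y in (0 : ℝ)..1, upperHeight r y) - ∫ y in (0 : ℝ)..1, lowerHeight r y) := by
  have h_upper := (continuous_upperHeight r).intervalIntegrable (μ := volume) 0 1
  have h_lower := (continuous_lowerHeight r).intervalIntegrable (μ := volume) 0 1
  have h_fiber : (fun y => volume (Prod.mk y ⁻¹' cutTriangle r)) =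
      (Set.Ioc 0 1).indicator fun y => ENNReal.ofReal (upperHeight r y - lowerHeight r y) := by
    funext y
    by_cases hy : y ∈ Set.Ioc 0 1
    · rw [volume_fiber_cutTriangle hy, Set.indicator_of_mem hy]
    · have h_empty : Prod.mk y ⁻¹' cutTriangle r = ∅ :=
        Set.eq_empty_of_forall_notMem fun _ hv => hy hv.1.1
      rw [h_empty, measure_empty, Set.indicator_of_notMem hy]
  have h_nonneg (y : ℝ) : 0 ≤ upperHeight r y - lowerHeight r y :=
    sub_nonneg.2 (lowerHeight_le_upperHeight r y)
  rw [hallTail, measureReal_def, Measure.volume_eq_prod,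
    Measure.prod_apply (measurableSet_cutTriangle r), h_fiber,
    lintegral_indicator measurableSet_Ioc,
    ← integral_eq_lintegral_of_nonneg_ae (ae_of_all _ h_nonneg)
      ((continuous_upperHeight r).sub (continuous_lowerHeight r)).aestronglyMeasurable,
    ← intervalIntegral.integral_of_le zero_le_one, intervalIntegral.integral_sub h_upper h_lower]

/-! ### Hall's formula -/

lemma integral_one_sub (a b : ℝ) :
    ∫ y in a..b, (1 - y) = (b - b ^ 2 / 2) - (a - a ^ 2 / 2) := by
  rw [intervalIntegral.integral_sub (by simp) (by simp), integral_one, integral_id]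
  ring

lemma integral_inv_mul_inv (r : ℝ) {a b : ℝ} (ha : 0 < a) (hb : 0 < b) :
    ∫ y in a..b, r⁻¹ * y⁻¹ = r⁻¹ * (Real.log b - Real.log a) := by
  rw [intervalIntegral.integral_const_mul, integral_inv_of_pos ha hb, Real.log_div hb.ne' ha.ne']

lemma integral_upperHeight_of_le_one {r : ℝ} (hr : r ≤ 1) :
    ∫ y in (0 : ℝ)..1, upperHeight r y = 1 := by
  have h_eq : Set.EqOn (upperHeight r) (fun _ => 1) (Set.uIcc 0 1) := fun y hy => by
    rw [Set.uIcc_of_le zero_le_one] at hy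
    exact upperHeight_of_le (by nlinarith [hy.1, hy.2])
  rw [intervalIntegral.integral_congr h_eq, integral_one, sub_zero]

lemma integral_upperHeight_of_one_le {r : ℝ} (hr : 1 ≤ r) :
    ∫ y in (0 : ℝ)..1, upperHeight r y = r⁻¹ + r⁻¹ * Real.log r := by
  have h_pos : 0 < r := by linarith
  have h_inv_pos : 0 < r⁻¹ := inv_pos.2 h_pos
  have h_flat : Set.EqOn (upperHeight r) (fun _ => 1) (Set.uIcc 0 r⁻¹) := fun y hy => by
    rw [Set.uIcc_of_le h_inv_pos.le] at hy
    exact upperHeight_of_le ((le_inv_mul_iff₀ h_pos).1 (by simpa using hy.2))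
  have h_hyperbola : Set.EqOn (upperHeight r) (fun y => r⁻¹ * y⁻¹) (Set.uIcc r⁻¹ 1) :=
    fun y hy => by
      rw [Set.uIcc_of_le (inv_le_one_of_one_le₀ hr)] at hy
      exact upperHeight_of_ge ((inv_mul_le_iff₀ h_pos).1 (by simpa using hy.1))
  have h_integrable := (continuous_upperHeight r).intervalIntegrable (μ := volume)
  rw [← intervalIntegral.integral_add_adjacent_intervals (h_integrable 0 r⁻¹) (h_integrable r⁻¹ 1),
    intervalIntegral.integral_congr h_flat, intervalIntegral.integral_congr h_hyperbola,
    integral_inv_mul_inv r h_inv_pos one_pos, integral_one, Real.log_one, Real.log_inv]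
  ring

lemma integral_lowerHeight_of_le_four {r : ℝ} (hr : r ≤ 4) :
    ∫ y in (0 : ℝ)..1, lowerHeight r y = 1 / 2 := by
  have h_eq : Set.EqOn (lowerHeight r) (fun y => 1 - y) (Set.uIcc 0 1) := fun y hy => by
    rw [Set.uIcc_of_le zero_le_one] at hy
    have : 0 ≤ y * (1 - y) := mul_nonneg hy.1 (by linarith [hy.2])
    exact lowerHeight_of_le hy.1 (by nlinarith [sq_nonneg (y - 1 / 2)])
  rw [intervalIntegral.integral_congr h_eq, integral_one_sub]
  norm_num

lemma integral_lowerHeight_of_mul_eq_one {r q : ℝ} (hr : 0 < r) (hq_pos : 0 < q) (hq : q ≤ 1 / 2)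
    (hqr : r * (q * (1 - q)) = 1) :
    ∫ y in (0 : ℝ)..1, lowerHeight r y = q + r⁻¹ * (2 * Real.log (1 - q) + Real.log r) := by
  have h_log : Real.log r + (Real.log q + Real.log (1 - q)) = 0 := by
    rw [← Real.log_mul hq_pos.ne' (by linarith), ← Real.log_mul hr.ne' (by nlinarith), hqr,
      Real.log_one]
  have h_left : Set.EqOn (lowerHeight r) (fun y => 1 - y) (Set.uIcc 0 q) := fun y hy => by
    rw [Set.uIcc_of_le hq_pos.le] at hy
    have : 0 ≤ (q - y) * ((1 - q) - y) := mul_nonneg (by linarith [hy.2]) (by linarith [hy.2])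
    exact lowerHeight_of_le hy.1 (by nlinarith)
  have h_middle : Set.EqOn (lowerHeight r) (fun y => r⁻¹ * y⁻¹) (Set.uIcc q (1 - q)) :=
    fun y hy => by
      rw [Set.uIcc_of_le (by linarith)] at hy
      have : 0 ≤ (y - q) * ((1 - q) - y) := mul_nonneg (by linarith [hy.1]) (by linarith [hy.2])
      exact lowerHeight_of_ge hr.le (by nlinarith)
  have h_right : Set.EqOn (lowerHeight r) (fun y => 1 - y) (Set.uIcc (1 - q) 1) := fun y hy => by
    rw [Set.uIcc_of_le (by linarith)] at hy
    have : 0 ≤ (y - q) * (y - (1 - q)) := mul_nonneg (by linarith [hy.1]) (by linarith [hy.1])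
    exact lowerHeight_of_le (by linarith [hy.1]) (by nlinarith)
  have h_integrable := (continuous_lowerHeight r).intervalIntegrable (μ := volume)
  rw [← intervalIntegral.integral_add_adjacent_intervals (h_integrable 0 q) (h_integrable q 1),
    ← intervalIntegral.integral_add_adjacent_intervals (h_integrable q (1 - q))
      (h_integrable (1 - q) 1), intervalIntegral.integral_congr h_left,
    intervalIntegral.integral_congr h_middle, intervalIntegral.integral_congr h_right,
    integral_inv_mul_inv r hq_pos (by linarith), integral_one_sub, integral_one_sub]
  linear_combination (-r⁻¹) * h_log

lemma hallTail_of_le_one {r : ℝ} (hr : r ≤ 1) : hallTail r = 1 := by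
  rw [hallTail_eq_integral, integral_upperHeight_of_le_one hr,
    integral_lowerHeight_of_le_four (by linarith)]
  norm_num

lemma hallTail_of_le_four {r : ℝ} (hr_one : 1 ≤ r) (hr_four : r ≤ 4) :
    hallTail r = -1 + 2 * r⁻¹ + 2 * r⁻¹ * Real.log r := by
  rw [hallTail_eq_integral, integral_upperHeight_of_one_le hr_one,
    integral_lowerHeight_of_le_four hr_four]
  ring

lemma hallTail_of_mul_eq_one {r q : ℝ} (hr : 1 ≤ r) (hq_pos : 0 < q) (hq : q ≤ 1 / 2)
    (hqr : r * (q * (1 - q)) = 1) :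
    hallTail r = 2 * r⁻¹ - 2 * q - 4 * r⁻¹ * Real.log (1 - q) := by
  rw [hallTail_eq_integral, integral_upperHeight_of_one_le hr,
    integral_lowerHeight_of_mul_eq_one (by linarith) hq_pos hq hqr]
  ring

/-- The smaller root `q` of `r * (q * (1 - q)) = 1`, the abscissa where the diagonal side of the
Farey triangle meets the hyperbola. It is real for `4 ≤ r`. -/
noncomputable def smallRoot (r : ℝ) : ℝ := 1 / 2 - Real.sqrt (1 / 4 - r⁻¹)

lemma smallRoot_le (r : ℝ) : smallRoot r ≤ 1 / 2 := sub_le_self _ (Real.sqrt_nonneg _)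

lemma smallRoot_pos {r : ℝ} (hr : 0 < r) : 0 < smallRoot r := by
  rw [smallRoot, sub_pos, Real.sqrt_lt' (by norm_num)]
  linarith [inv_pos.2 hr]

lemma mul_smallRoot_mul_one_sub {r : ℝ} (hr : 4 ≤ r) :
    r * (smallRoot r * (1 - smallRoot r)) = 1 := by
  have h_inv : r⁻¹ ≤ 1 / 4 := by
    rw [one_div]
    exact inv_anti₀ (by norm_num) hr
  have h_sq := Real.sq_sqrt (sub_nonneg.2 h_inv)
  have h_cancel : r * r⁻¹ = 1 := mul_inv_cancel₀ (by linarith)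
  rw [smallRoot]
  linear_combination (-r) * h_sq + h_cancel

lemma hallTail_of_four_le {r : ℝ} (hr : 4 ≤ r) :
    hallTail r = -1 + 2 * r⁻¹ + 2 * Real.sqrt (1 / 4 - r⁻¹)
      - 4 * r⁻¹ * Real.log (1 / 2 + Real.sqrt (1 / 4 - r⁻¹)) := by
  rw [hallTail_of_mul_eq_one (by linarith) (smallRoot_pos (by linarith)) (smallRoot_le r)
    (mul_smallRoot_mul_one_sub hr), smallRoot]
  ring_nf

/-! ### Asymptotics -/

lemma tendsto_smallRoot_atTop : Tendsto smallRoot atTop (𝓝[≠] 0) := by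
  have h_sqrt : Real.sqrt (1 / 4) = 1 / 2 := by
    rw [show (1 / 4 : ℝ) = (1 / 2) ^ 2 by norm_num, Real.sqrt_sq (by norm_num)]
  refine tendsto_nhdsWithin_iff.2 ⟨?_, ?_⟩
  · have h_lim := ((tendsto_inv_atTop_zero (𝕜 := ℝ)).const_sub (1 / 4)).sqrt.const_sub (1 / 2)
    rwa [sub_zero, h_sqrt, sub_self] at h_lim
  · filter_upwards [eventually_gt_atTop 0] with r hr using (smallRoot_pos hr).ne'

lemma tendsto_inv_mul_log_one_sub :
    Tendsto (fun q : ℝ => q⁻¹ * Real.log (1 - q)) (𝓝[≠] 0) (𝓝 (-1)) := by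
  have h_deriv : HasDerivAt (fun q : ℝ => Real.log (1 - q)) (-1) 0 := by
    simpa using ((hasDerivAt_id (0 : ℝ)).const_sub 1).log (by simp)
  simpa using hasDerivAt_iff_tendsto_slope_zero.1 h_deriv

lemma hallTail_mul_sq {r : ℝ} (hr : 4 ≤ r) :
    hallTail r * r ^ 2 = (-2 - 4 * (1 - smallRoot r) *
      ((smallRoot r)⁻¹ * Real.log (1 - smallRoot r))) / (1 - smallRoot r) ^ 2 := by
  have h_pos := smallRoot_pos (show 0 < r by linarith)
  have h_one_sub_pos : 0 < 1 - smallRoot r := by linarith [smallRoot_le r]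
  have h_root := mul_smallRoot_mul_one_sub hr
  rw [hallTail_of_mul_eq_one (by linarith) h_pos (smallRoot_le r) h_root]
  generalize smallRoot r = q at *
  obtain rfl : r = 1 / (q * (1 - q)) := (eq_div_iff (by positivity)).2 h_root
  field_simp
  ring

lemma tendsto_hallTail_mul_sq : Tendsto (fun r => hallTail r * r ^ 2) atTop (𝓝 2) := by
  have h_one_sub : Tendsto (fun q : ℝ => 1 - q) (𝓝[≠] 0) (𝓝 1) := by
    simpa using ((tendsto_id (x := 𝓝 (0 : ℝ))).mono_left nhdsWithin_le_nhds).const_sub (1 : ℝ)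
  have h_lim : Tendsto (fun q : ℝ => (-2 - 4 * (1 - q) * (q⁻¹ * Real.log (1 - q))) / (1 - q) ^ 2)
      (𝓝[≠] 0) (𝓝 2) := by
    convert! (((h_one_sub.const_mul 4).mul tendsto_inv_mul_log_one_sub).const_sub (-2)).div
      (h_one_sub.pow 2) (by norm_num) using 2
    norm_num
  refine (h_lim.comp tendsto_smallRoot_atTop).congr' ?_
  filter_upwards [eventually_ge_atTop 4] with r hr using (hallTail_mul_sq hr).symm

lemma hittingDensity_isEquivalent :
    hittingDensity ~[atTop] fun r : ℝ => 6 / Real.pi ^ 2 * (r ^ 2)⁻¹ := by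
  have h_lim := tendsto_hallTail_mul_sq.div_const 2
  rw [div_self two_ne_zero] at h_lim
  refine isEquivalent_of_tendsto_one (h_lim.congr' ?_)
  filter_upwards [eventually_gt_atTop 0] with r hr
  have := Real.pi_pos
  rw [Pi.div_apply, hittingDensity_eq]
  field_simp
  ring

lemma extremeDensity_isEquivalent :
    extremeDensity ~[atBot] fun s : ℝ => 6 / Real.pi ^ 2 * Real.exp (-|s|) := by
  have h := (IsEquivalent.refl (u := fun s : ℝ => Real.exp (-s)) (l := atBot)).mul
    (hittingDensity_isEquivalent.comp_tendsto
      (Real.tendsto_exp_atTop.comp tendsto_neg_atBot_atTop))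
  refine h.congr_right ?_
  filter_upwards [eventually_le_atBot 0] with s hs
  simp only [Pi.mul_apply, Function.comp_apply]
  rw [abs_of_nonpos hs, neg_neg, Real.exp_neg]
  field_simp

/-! ### The extreme value density -/

lemma extremeDensity_eq (s : ℝ) :
    extremeDensity s = 3 / Real.pi ^ 2 * (Real.exp (-s) * hallTail (Real.exp (-s))) := by
  rw [extremeDensity, hittingDensity_eq]
  ring

lemma extremeDensity_of_nonneg {s : ℝ} (hs : 0 ≤ s) :
    extremeDensity s = 3 / Real.pi ^ 2 * Real.exp (-s) := by
  rw [extremeDensity_eq, hallTail_of_le_one (Real.exp_le_one_iff.2 (neg_nonpos.2 hs)), mul_one]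

lemma exp_two_mul_log_two : Real.exp (2 * Real.log 2) = 4 := by
  rw [two_mul, Real.exp_add, Real.exp_log two_pos]
  norm_num

lemma extremeDensity_of_nonpos {s : ℝ} (hs : s ≤ 0) (hs_log : -2 * Real.log 2 ≤ s) :
    extremeDensity s = 3 / Real.pi ^ 2 * (-Real.exp (-s) + 2 - 2 * s) := by
  have h_le : Real.exp (-s) ≤ 4 := exp_two_mul_log_two ▸ Real.exp_le_exp.2 (by linarith)
  rw [extremeDensity_eq, hallTail_of_le_four (Real.one_le_exp (neg_nonneg.2 hs)) h_le, Real.log_exp]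
  field_simp
  ring

lemma extremeDensity_of_le {s : ℝ} (hs : s ≤ -2 * Real.log 2) :
    extremeDensity s = 3 / Real.pi ^ 2 * (-Real.exp (-s) + 2
      + 2 * Real.exp (-s) * Real.sqrt (1 / 4 - Real.exp s)
      - 4 * Real.log (1 / 2 + Real.sqrt (1 / 4 - Real.exp s))) := by
  have h_le : 4 ≤ Real.exp (-s) := exp_two_mul_log_two ▸ Real.exp_le_exp.2 (by linarith)
  rw [extremeDensity_eq, hallTail_of_four_le h_le, ← Real.exp_neg, neg_neg, Real.exp_neg]
  field_simp

/-! ### Counting primitive lattice points -/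

section PrimitivePoints

open Bornology Pointwise
open scoped ArithmeticFunction.Moebius

lemma hasSum_moebius_dvd {n : ℕ} (hn : n ≠ 0) :
    HasSum (fun d : ℕ => if d ∣ n then (μ d : ℝ) else 0) (if n = 1 then 1 else 0) := by
  have h_sum : ∑ d ∈ n.divisors, (μ d : ℝ) = if n = 1 then 1 else 0 := by
    rw [← Int.cast_sum, ← ArithmeticFunction.coe_mul_zeta_apply,
      ArithmeticFunction.moebius_mul_coe_zeta, ArithmeticFunction.one_apply]
    push_cast
    rfl
  rw [← h_sum, ← Finset.sum_congr rfl fun d hd => if_pos (Nat.dvd_of_mem_divisors hd)]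
  exact hasSum_sum_of_ne_finset_zero fun d hd =>
    if_neg fun h_dvd => hd (Nat.mem_divisors.2 ⟨h_dvd, hn⟩)

lemma hasSum_moebius_mul_ncard {α : Type*} {T : Set α} (hT : T.Finite) {g : α → ℕ}
    (hg : ∀ x ∈ T, g x ≠ 0) :
    HasSum (fun d : ℕ => (μ d : ℝ) * {x ∈ T | d ∣ g x}.ncard) {x ∈ T | g x = 1}.ncard := by
  classical
  lift T to Finset α using hT
  have h_ncard (P : α → Prop) [DecidablePred P] :
      ({x ∈ (T : Set α) | P x}.ncard : ℝ) = ∑ x ∈ T, if P x then 1 else 0 := by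
    rw [← Finset.sum_filter, Finset.sum_const, nsmul_one, ← Set.ncard_coe_finset,
      Finset.coe_filter]
    rfl
  simp only [h_ncard, Finset.mul_sum, mul_ite, mul_one, mul_zero]
  exact hasSum_sum fun x hx => hasSum_moebius_dvd (hg x hx)

lemma tsum_moebius_div_pow_ne_zero {k : ℕ} (hk : 2 ≤ k) :
    ∑' d : ℕ, (μ d : ℝ) / (d : ℝ) ^ k ≠ 0 := by
  intro h
  have h_re : 1 < (k : ℂ).re := by
    rw [Complex.natCast_re]
    exact_mod_cast hk
  have h_series : LSeries (fun n => ((μ n : ℤ) : ℂ)) k =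
      ((∑' d : ℕ, (μ d : ℝ) / (d : ℝ) ^ k : ℝ) : ℂ) := by
    rw [LSeries, Complex.ofReal_tsum]
    refine tsum_congr fun n => ?_
    rcases eq_or_ne n 0 with rfl | hn
    · simp
    · rw [LSeries.term_of_ne_zero hn]
      norm_num
  have h_mul := ArithmeticFunction.LSeries_zeta_mul_Lseries_moebius h_re
  rw [h_series, h, Complex.ofReal_zero, mul_zero] at h_mul
  exact zero_ne_one h_mul

variable {ι : Type*}

/-- The integer vectors `x` with `x / N ∈ S`, i.e. the lattice points in the dilate `N • S`. -/
def dilateLatticePoints (S : Set (ι → ℝ)) (N : ℕ) : Set (ι → ℤ) :=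
  {x | (fun i => (x i : ℝ) / N) ∈ S}

variable {S : Set (ι → ℝ)}

lemma zero_notMem_dilateLatticePoints (h_zero : 0 ∉ S) (N : ℕ) :
    0 ∉ dilateLatticePoints S N := fun h => h_zero <| by
  simpa [dilateLatticePoints, ← Pi.zero_def] using h

variable [Fintype ι]

/-- The greatest common divisor of the coordinates of an integer vector, which is `1` exactly when
the vector is primitive. -/
def content (x : ι → ℤ) : ℕ := Finset.univ.gcd fun i => (x i).natAbs

lemma dvd_content {d : ℕ} {x : ι → ℤ} : d ∣ content x ↔ ∀ i, (d : ℤ) ∣ x i := by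
  simp only [content, Finset.dvd_gcd_iff, Finset.mem_univ, true_imp_iff, Int.natCast_dvd]

lemma content_ne_zero {x : ι → ℤ} (hx : x ≠ 0) : content x ≠ 0 := fun h =>
  hx <| funext fun i => Int.natAbs_eq_zero.1 (Finset.gcd_eq_zero_iff.1 h i (Finset.mem_univ i))

lemma tendsto_ncard_dilateLatticePoints (h_bdd : IsBounded S) (h_meas : MeasurableSet S)
    (h_frontier : volume (frontier S) = 0) :
    Tendsto (fun N : ℕ => ((dilateLatticePoints S N).ncard : ℝ) / N ^ Fintype.card ι) atTop
      (𝓝 (volume.real S)) := by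
  refine (tendsto_card_div_pow_atTop_volume S h_bdd h_meas h_frontier).congr' ?_
  filter_upwards [eventually_ne_atTop 0] with N hN
  have hN' : (N : ℝ) ≠ 0 := Nat.cast_ne_zero.2 hN
  let rescale : (ι → ℤ) → ι → ℝ := fun x i => (x i : ℝ) / N
  have h_inj : rescale.Injective := fun x y h => funext fun i =>
    Int.cast_injective ((div_left_inj' hN').1 (congrFun h i))
  have h_image : rescale '' dilateLatticePoints S N =
      S ∩ (N : ℝ)⁻¹ • (Submodule.span ℤ (Set.range (Pi.basisFun ℝ ι)) : Set (ι → ℝ)) := by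
    ext z
    simp only [Set.mem_inter_iff, Set.mem_inv_smul_set_iff₀ hN', SetLike.mem_coe,
      Module.Basis.mem_span_iff_repr_mem, Pi.basisFun_repr, Set.mem_range]
    constructor
    · rintro ⟨x, hx, rfl⟩
      exact ⟨hx, fun i => ⟨x i, (mul_div_cancel₀ _ hN').symm⟩⟩
    · rintro ⟨hz, h_int⟩
      choose x hx using h_int
      obtain rfl : rescale x = z := funext fun i => by
        rw [div_eq_iff hN', mul_comm]
        exact hx i
      exact ⟨x, hz, rfl⟩
  rw [← h_image, Nat.card_coe_set_eq, Set.ncard_image_of_injective _ h_inj]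

lemma dilateLatticePoints_subset_Icc {R : ℝ} (h_ball : S ⊆ Metric.closedBall 0 R) {N : ℕ}
    (hN : N ≠ 0) :
    dilateLatticePoints S N ⊆ Set.Icc (fun _ => -(⌊R * N⌋₊ : ℤ)) fun _ => (⌊R * N⌋₊ : ℤ) := by
  intro x hx
  rw [← Set.pi_univ_Icc]
  intro i _
  have hN' : (0 : ℝ) < N := Nat.cast_pos.2 hN.bot_lt
  have h_norm : |(x i : ℝ)| / N ≤ R := by
    have h := (norm_le_pi_norm _ i).trans (mem_closedBall_zero_iff.1 (h_ball hx))
    rwa [Real.norm_eq_abs, abs_div, abs_of_pos hN'] at h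
  rw [Set.mem_Icc, ← abs_le, Int.abs_eq_natAbs, Nat.cast_le]
  refine Nat.le_floor ?_
  rw [Nat.cast_natAbs, Int.cast_abs]
  exact (div_le_iff₀ hN').1 h_norm

lemma finite_dilateLatticePoints {κ : Type*} [Finite κ] {S : Set (κ → ℝ)} (h_bdd : IsBounded S)
    {N : ℕ} (hN : N ≠ 0) :
    (dilateLatticePoints S N).Finite := by
  classical
  have := Fintype.ofFinite κ
  obtain ⟨R, hR⟩ := h_bdd.subset_closedBall 0
  exact (Set.finite_Icc _ _).subset (dilateLatticePoints_subset_Icc hR hN)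

lemma ncard_dilateLatticePoints_le {R : ℝ} (hR : 0 ≤ R) (h_ball : S ⊆ Metric.closedBall 0 R)
    (h_zero : 0 ∉ S) {N : ℕ} (hN : N ≠ 0) :
    ((dilateLatticePoints S N).ncard : ℝ) ≤ (3 * (R * N)) ^ Fintype.card ι := by
  classical
  have h_subset := dilateLatticePoints_subset_Icc h_ball hN
  rcases Nat.eq_zero_or_pos ⌊R * N⌋₊ with h | h
  · have h_empty : dilateLatticePoints S N = ∅ := by
      refine Set.eq_empty_of_forall_notMem fun x hx => ?_
      have h_mem := h_subset hx
      rw [h, Nat.cast_zero, neg_zero, ← Pi.zero_def, Set.Icc_self] at h_mem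
      obtain rfl : x = 0 := h_mem
      exact zero_notMem_dilateLatticePoints h_zero N hx
    rw [h_empty, Set.ncard_empty, Nat.cast_zero]
    positivity
  · have h_ncard : (dilateLatticePoints S N).ncard ≤ (2 * ⌊R * N⌋₊ + 1) ^ Fintype.card ι := by
      refine (Set.ncard_le_ncard h_subset (Set.finite_Icc _ _)).trans_eq ?_
      rw [← Finset.coe_Icc, Set.ncard_coe_finset, Pi.card_Icc, Finset.prod_const,
        Finset.card_univ, Int.card_Icc]
      congr 1
      omega
    have h_floor := Nat.floor_le (by positivity : 0 ≤ R * N)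
    have h_one : (1 : ℝ) ≤ ⌊R * N⌋₊ := Nat.one_le_cast.2 h
    calc ((dilateLatticePoints S N).ncard : ℝ) ≤ (2 * ⌊R * N⌋₊ + 1 : ℝ) ^ Fintype.card ι := by
          exact_mod_cast h_ncard
      _ ≤ (3 * (R * N)) ^ Fintype.card ι := by
          gcongr
          linarith

lemma ncard_dilateLatticePoints_dvd_content {d : ℕ} (hd : d ≠ 0) (N : ℕ) :
    {x ∈ dilateLatticePoints S N | d ∣ content x}.ncard =
      (dilateLatticePoints ((d : ℝ)⁻¹ • S) N).ncard := by
  have hd' : (d : ℤ) ≠ 0 := Nat.cast_ne_zero.2 hd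
  have h_mem (z : ι → ℤ) : (d : ℤ) • z ∈ dilateLatticePoints S N ↔
      z ∈ dilateLatticePoints ((d : ℝ)⁻¹ • S) N := by
    rw [dilateLatticePoints, dilateLatticePoints, Set.mem_ofPred_eq, Set.mem_ofPred_eq,
      Set.mem_inv_smul_set_iff₀ (Nat.cast_ne_zero.2 hd)]
    congr! 2 with i
    simp [mul_div_assoc]
  have h_image : (fun z => (d : ℤ) • z) '' dilateLatticePoints ((d : ℝ)⁻¹ • S) N =
      {x ∈ dilateLatticePoints S N | d ∣ content x} := by
    ext x
    constructor
    · rintro ⟨z, hz, rfl⟩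
      exact ⟨(h_mem z).2 hz, dvd_content.2 fun i => dvd_mul_right _ _⟩
    · rintro ⟨hx, h_dvd⟩
      choose z hz using dvd_content.1 h_dvd
      obtain rfl : x = (d : ℤ) • z := funext hz
      exact ⟨z, (h_mem z).1 hx, rfl⟩
  rw [← h_image, Set.ncard_image_of_injective _ (smul_right_injective _ hd')]

lemma volume_frontier_smul_eq_zero (h_frontier : volume (frontier S) = 0) {c : ℝ} (hc : c ≠ 0) :
    volume (frontier (c • S)) = 0 := by
  have h_image : c • frontier S = frontier (c • S) :=
    (Homeomorph.smulOfNeZero c hc).image_frontier S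
  rw [← h_image, Measure.addHaar_smul, h_frontier, mul_zero]

lemma tendsto_ncard_dvd_content (h_bdd : IsBounded S) (h_meas : MeasurableSet S)
    (h_frontier : volume (frontier S) = 0) {d : ℕ} (hd : d ≠ 0) :
    Tendsto (fun N : ℕ =>
        ({x ∈ dilateLatticePoints S N | d ∣ content x}.ncard : ℝ) / N ^ Fintype.card ι) atTop
      (𝓝 (volume.real S / d ^ Fintype.card ι)) := by
  have hd' : (d : ℝ)⁻¹ ≠ 0 := inv_ne_zero (Nat.cast_ne_zero.2 hd)
  have h_volume : volume.real ((d : ℝ)⁻¹ • S) = volume.real S / d ^ Fintype.card ι := by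
    rw [measureReal_def, Measure.addHaar_smul, ENNReal.toReal_mul,
      ENNReal.toReal_ofReal (abs_nonneg _), Module.finrank_fintype_fun_eq_card, inv_pow,
      abs_of_nonneg (by positivity), ← measureReal_def, inv_mul_eq_div]
  simp only [ncard_dilateLatticePoints_dvd_content hd, ← h_volume]
  exact tendsto_ncard_dilateLatticePoints (h_bdd.smul₀ _) (h_meas.const_smul_of_ne_zero hd')
    (volume_frontier_smul_eq_zero h_frontier hd')

lemma ncard_dvd_content_le {R : ℝ} (hR : 0 ≤ R) (h_ball : S ⊆ Metric.closedBall 0 R)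
    (h_zero : 0 ∉ S) {d N : ℕ} (hd : d ≠ 0) (hN : N ≠ 0) :
    ({x ∈ dilateLatticePoints S N | d ∣ content x}.ncard : ℝ) / N ^ Fintype.card ι ≤
      (3 * R) ^ Fintype.card ι * (1 / (d : ℝ) ^ Fintype.card ι) := by
  have hd' : (d : ℝ)⁻¹ ≠ 0 := inv_ne_zero (Nat.cast_ne_zero.2 hd)
  have h_ball' : (d : ℝ)⁻¹ • S ⊆ Metric.closedBall 0 ((d : ℝ)⁻¹ * R) := by
    refine (Set.smul_set_mono h_ball).trans_eq ?_
    rw [smul_closedBall _ _ hR, smul_zero, norm_inv, Real.norm_natCast]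
  have h_zero' : (0 : ι → ℝ) ∉ (d : ℝ)⁻¹ • S := by
    rwa [Set.zero_mem_smul_set_iff hd']
  rw [ncard_dilateLatticePoints_dvd_content hd, div_le_iff₀ (by positivity)]
  refine (ncard_dilateLatticePoints_le (by positivity) h_ball' h_zero' hN).trans_eq ?_
  rw [← one_div_pow, ← mul_pow, ← mul_pow]
  ring

lemma norm_moebius_mul_ncard_dvd_content_le {R : ℝ} (hR : 0 ≤ R)
    (h_ball : S ⊆ Metric.closedBall 0 R) (h_zero : 0 ∉ S) (d : ℕ) {N : ℕ} (hN : N ≠ 0) :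
    ‖(μ d : ℝ) *
      (({x ∈ dilateLatticePoints S N | d ∣ content x}.ncard : ℝ) / N ^ Fintype.card ι)‖ ≤
      (3 * R) ^ Fintype.card ι * (1 / (d : ℝ) ^ Fintype.card ι) := by
  rcases eq_or_ne d 0 with rfl | hd
  · rw [ArithmeticFunction.map_zero, Int.cast_zero, zero_mul, norm_zero]
    positivity
  · have h_moebius_le : |(μ d : ℝ)| ≤ 1 := by
      exact_mod_cast ArithmeticFunction.abs_moebius_le_one (n := d)
    rw [norm_mul, Real.norm_of_nonneg (by positivity : (0 : ℝ) ≤ _ / _)]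
    exact (mul_le_of_le_one_left (by positivity) h_moebius_le).trans
      (ncard_dvd_content_le hR h_ball h_zero hd hN)

theorem tendsto_ncard_primitive (h_card : 2 ≤ Fintype.card ι) (h_bdd : IsBounded S)
    (h_meas : MeasurableSet S) (h_frontier : volume (frontier S) = 0) (h_zero : 0 ∉ S) :
    Tendsto (fun N : ℕ =>
        ({x ∈ dilateLatticePoints S N | content x = 1}.ncard : ℝ) / N ^ Fintype.card ι) atTop
      (𝓝 (volume.real S * ∑' d : ℕ, (μ d : ℝ) / (d : ℝ) ^ Fintype.card ι)) := by
  obtain ⟨R, hR, h_ball⟩ := h_bdd.subset_closedBall_lt 0 0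
  have h_moebius (N : ℕ) (hN : N ≠ 0) : HasSum (fun d : ℕ => (μ d : ℝ) *
      (({x ∈ dilateLatticePoints S N | d ∣ content x}.ncard : ℝ) / N ^ Fintype.card ι))
      (({x ∈ dilateLatticePoints S N | content x = 1}.ncard : ℝ) / N ^ Fintype.card ι) := by
    simp only [← mul_div_assoc]
    have h_content (x) (hx : x ∈ dilateLatticePoints S N) : content x ≠ 0 :=
      content_ne_zero fun h => zero_notMem_dilateLatticePoints h_zero N (h ▸ hx)
    exact (hasSum_moebius_mul_ncard (finite_dilateLatticePoints h_bdd hN) h_content).div_const _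
  have h_term (d : ℕ) : Tendsto (fun N : ℕ => (μ d : ℝ) *
      (({x ∈ dilateLatticePoints S N | d ∣ content x}.ncard : ℝ) / N ^ Fintype.card ι)) atTop
      (𝓝 (volume.real S * ((μ d : ℝ) / (d : ℝ) ^ Fintype.card ι))) := by
    rcases eq_or_ne d 0 with rfl | hd
    · simp
    · rw [mul_div_left_comm]
      exact (tendsto_ncard_dvd_content h_bdd h_meas h_frontier hd).const_mul _
  have h_summable := (Real.summable_one_div_nat_pow.2 h_card).mul_left
    ((3 * R) ^ Fintype.card ι)
  rw [← tsum_mul_left]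
  refine (tendsto_tsum_of_dominated_convergence h_summable h_term ?_).congr' ?_
  · filter_upwards [eventually_ne_atTop 0] with N hN d
      using norm_moebius_mul_ncard_dvd_content_le hR.le h_ball h_zero d hN
  · filter_upwards [eventually_ne_atTop 0] with N hN using (h_moebius N hN).tsum_eq

end PrimitivePoints

/-! ### Gaps in the Farey sequence -/

/-- Two fractions `x < y` in `[0, 1]` with denominators at most `N`, of determinant one and with
denominators adding up to more than `N`: the arithmetic description of a pair of consecutive Farey
fractions of level `N`. -/
structure IsFareyNeighbour (N : ℕ) (x y : ℚ) : Prop where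
  nonneg : 0 ≤ x
  le_one : y ≤ 1
  den_left_le : x.den ≤ N
  den_right_le : y.den ≤ N
  det_eq_one : y.num * x.den - x.num * y.den = 1
  lt_den_add_den : N < x.den + y.den

lemma exists_det_eq_one {p q : ℤ} (hq : 0 < q) (h : IsCoprime p q) (n : ℤ) :
    ∃ a b : ℤ, a * q - p * b = 1 ∧ b ∈ Set.Ioc (n - q) n := by
  obtain ⟨u, v, huv⟩ := h
  have h_div := Int.emod_add_mul_ediv (n + u) q
  have h_nonneg := Int.emod_nonneg (n + u) hq.ne'
  have h_lt := Int.emod_lt_of_pos (n + u) hq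
  refine ⟨v + p * ((n + u) / q), -u + q * ((n + u) / q), ?_, ?_, ?_⟩
  · linear_combination huv
  · linarith
  · linarith

lemma exists_rat_num_den {a b : ℤ} (hb : 0 < b) (h : IsCoprime a b) :
    ∃ z : ℚ, z.num = a ∧ (z.den : ℤ) = b :=
  have h_coprime : a.natAbs.Coprime b.natAbs := Int.isCoprime_iff_gcd_eq_one.1 h
  ⟨a / b, Rat.num_div_eq_of_coprime hb h_coprime, Rat.den_div_eq_of_coprime hb h_coprime⟩

lemma rat_le_one_iff {x : ℚ} : x ≤ 1 ↔ x.num ≤ x.den := by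
  simp [Rat.le_iff]

lemma rat_lt_one_iff {x : ℚ} : x < 1 ↔ x.num < x.den := by
  simp [Rat.lt_iff]

namespace IsFareyNeighbour

variable {N : ℕ} {x y x' y' : ℚ}

lemma lt (h : IsFareyNeighbour N x y) : x < y := by
  rw [Rat.lt_iff]
  linarith [h.det_eq_one]

lemma left_lt_one (h : IsFareyNeighbour N x y) : x < 1 := h.lt.trans_le h.le_one

lemma isCoprime_den (h : IsFareyNeighbour N x y) : IsCoprime (x.den : ℤ) y.den :=
  ⟨y.num, -x.num, by linarith [h.det_eq_one]⟩

lemma mem_fareyPairs (h : IsFareyNeighbour N x y) : (x, y) ∈ fareyPairs N := by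
  refine ⟨⟨h.nonneg, h.left_lt_one.le, h.den_left_le⟩,
    ⟨h.nonneg.trans h.lt.le, h.le_one, h.den_right_le⟩, h.lt, ?_⟩
  rintro z ⟨-, -, hz⟩ ⟨hxz, hzy⟩
  rw [Rat.lt_iff] at hxz hzy
  -- A fraction strictly between `x` and `y` has denominator at least `x.den + y.den`.
  have h_den : (z.den : ℤ) = x.den * (y.num * z.den - z.num * y.den)
      + y.den * (z.num * x.den - x.num * z.den) := by
    linear_combination (-(z.den : ℤ)) * h.det_eq_one
  have hx : (x.den : ℤ) ≤ x.den * (y.num * z.den - z.num * y.den) :=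
    le_mul_of_one_le_right (Nat.cast_nonneg _) (by linarith)
  have hy : (y.den : ℤ) ≤ y.den * (z.num * x.den - x.num * z.den) :=
    le_mul_of_one_le_right (Nat.cast_nonneg _) (by linarith)
  have h_lt := h.lt_den_add_den
  lia

lemma eq_of_den_eq (h : IsFareyNeighbour N x y) (h' : IsFareyNeighbour N x' y')
    (hx : x.den = x'.den) (hy : y.den = y'.den) : x = x' ∧ y = y' := by
  have h_lt := rat_lt_one_iff.1 h.left_lt_one
  have h_lt' := rat_lt_one_iff.1 h'.left_lt_one
  have h_nonneg := Rat.num_nonneg.2 h.nonneg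
  have h_nonneg' := Rat.num_nonneg.2 h'.nonneg
  have h_det := h.det_eq_one
  have h_det' := h'.det_eq_one
  rw [← hx] at h_lt' h_det'
  rw [← hy] at h_det'
  have h_dvd : (x.den : ℤ) ∣ x.num - x'.num := by
    refine h.isCoprime_den.dvd_of_dvd_mul_right ⟨y.num - y'.num, ?_⟩
    linear_combination h_det' - h_det
  have h_left : x.num = x'.num := by
    refine sub_eq_zero.1 (Int.eq_zero_of_abs_lt_dvd h_dvd ?_)
    rw [abs_lt]
    constructor <;> linarith
  have h_right : y.num = y'.num := by
    refine mul_right_cancel₀ (Nat.cast_ne_zero.2 x.den_ne_zero : (x.den : ℤ) ≠ 0) ?_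
    rw [h_left] at h_det
    linarith
  exact ⟨Rat.ext h_left hx, Rat.ext h_right hy⟩

lemma sub_eq (h : IsFareyNeighbour N x y) : (y : ℝ) - x = 1 / (x.den * y.den) := by
  have hx : (x.den : ℝ) ≠ 0 := Nat.cast_ne_zero.2 x.den_ne_zero
  have hy : (y.den : ℝ) ≠ 0 := Nat.cast_ne_zero.2 y.den_ne_zero
  have h_det : (y.num * x.den - x.num * y.den : ℝ) = 1 := by exact_mod_cast h.det_eq_one
  rw [Rat.cast_def x, Rat.cast_def y, div_sub_div _ _ hy hx, mul_comm (y.den : ℝ) x.num, h_det,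
    mul_comm]

lemma den_div_mem_fareyTriangle (h : IsFareyNeighbour N x y) :
    ((x.den : ℝ) / N, (y.den : ℝ) / N) ∈ fareyTriangle := by
  have hx : (0 : ℝ) < x.den := Nat.cast_pos.2 x.den_pos
  have hxN : (x.den : ℝ) ≤ N := Nat.cast_le.2 h.den_left_le
  have hyN : (y.den : ℝ) ≤ N := Nat.cast_le.2 h.den_right_le
  have hN : (0 : ℝ) < N := hx.trans_le hxN
  have h_lt : (N : ℝ) < x.den + y.den := by exact_mod_cast h.lt_den_add_den
  refine ⟨⟨by positivity, (div_le_one hN).2 hxN⟩, ?_, (div_le_one hN).2 hyN⟩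
  rwa [sub_lt_iff_lt_add', ← add_div, one_lt_div hN]

lemma den_div_mem_cutTriangle_iff (h : IsFareyNeighbour N x y) (r : ℝ) :
    ((x.den : ℝ) / N, (y.den : ℝ) / N) ∈ cutTriangle r ↔ r < N ^ 2 * ((y : ℝ) - x) := by
  have h_mul : (0 : ℝ) < x.den * y.den := by exact_mod_cast Nat.mul_pos x.den_pos y.den_pos
  have hN : (0 : ℝ) < N := Nat.cast_pos.2 (x.den_pos.trans_le h.den_left_le)
  have h_iff : ((x.den : ℝ) / N, (y.den : ℝ) / N) ∈ cutTriangle r ↔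
      r * (x.den / N * (y.den / N)) < 1 :=
    and_iff_right h.den_div_mem_fareyTriangle
  rw [h_iff, h.sub_eq, mul_one_div, lt_div_iff₀ h_mul, div_mul_div_comm, ← sq,
    mul_div_assoc', div_lt_one (pow_pos hN 2)]

end IsFareyNeighbour

lemma exists_isFareyNeighbour {N : ℕ} {x : ℚ} (hx : x ∈ farey N) (h_lt : x < 1) :
    ∃ z, IsFareyNeighbour N x z := by
  have h_pos : (0 : ℤ) < x.den := Nat.cast_pos.2 x.den_pos
  have h_coprime : IsCoprime x.num (x.den : ℤ) := Int.isCoprime_iff_gcd_eq_one.2 x.reduced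
  obtain ⟨a, b, h_det, hb_gt, hb_le⟩ := exists_det_eq_one h_pos h_coprime N
  have h_den : (x.den : ℤ) ≤ N := Nat.cast_le.2 hx.2.2
  have hb : 0 < b := by linarith
  obtain ⟨z, rfl, rfl⟩ := exists_rat_num_den (a := a) hb ⟨x.den, -x.num, by linarith⟩
  have h_num : x.num < x.den := rat_lt_one_iff.1 h_lt
  exact ⟨z,
    { nonneg := hx.1
      le_one := rat_le_one_iff.2 (by nlinarith)
      den_left_le := hx.2.2
      den_right_le := by exact_mod_cast hb_le
      det_eq_one := h_det
      lt_den_add_den := by zify; linarith }⟩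

theorem mem_fareyPairs_iff {N : ℕ} {x y : ℚ} :
    (x, y) ∈ fareyPairs N ↔ IsFareyNeighbour N x y := by
  refine ⟨?_, IsFareyNeighbour.mem_fareyPairs⟩
  rintro ⟨hx, hy, h_lt, h_consecutive⟩
  obtain ⟨z, hz⟩ := exists_isFareyNeighbour hx (h_lt.trans_le hy.2.1)
  obtain ⟨-, hz_mem, -, hz_consecutive⟩ := hz.mem_fareyPairs
  rcases lt_trichotomy y z with h | rfl | h
  · exact absurd ⟨h_lt, h⟩ (hz_consecutive y hy)
  · exact hz
  · exact absurd ⟨hz.lt, h⟩ (h_consecutive z hz_mem)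

lemma exists_isFareyNeighbour_of_mem {N : ℕ} (hN : N ≠ 0) {a b : ℤ}
    (h_mem : ((a : ℝ) / N, (b : ℝ) / N) ∈ fareyTriangle) (h_coprime : IsCoprime a b) :
    ∃ x y : ℚ, IsFareyNeighbour N x y ∧ (x.den : ℤ) = a ∧ (y.den : ℤ) = b := by
  have hN' : (0 : ℝ) < N := Nat.cast_pos.2 hN.bot_lt
  obtain ⟨⟨ha, ha_le⟩, h_lt, hb_le⟩ := h_mem
  simp only [sub_lt_iff_lt_add', ← add_div, div_pos_iff_of_pos_right hN', div_le_one hN',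
    one_lt_div hN'] at ha ha_le h_lt hb_le
  norm_cast at ha ha_le h_lt hb_le
  have hb : 0 < b := by linarith
  obtain ⟨c, p, h_det, hp_gt, hp_le⟩ := exists_det_eq_one ha h_coprime.symm (a - 1)
  obtain ⟨x, rfl, rfl⟩ := exists_rat_num_den (a := p) ha ⟨-b, c, by linarith⟩
  obtain ⟨y, rfl, rfl⟩ := exists_rat_num_den (a := c) hb ⟨x.den, -x.num, by linarith⟩
  have h_neighbour : IsFareyNeighbour N x y :=
    { nonneg := Rat.num_nonneg.1 (by linarith)
      le_one := rat_le_one_iff.2 (by nlinarith)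
      den_left_le := by exact_mod_cast ha_le
      den_right_le := by exact_mod_cast hb_le
      det_eq_one := by linarith
      lt_den_add_den := by exact_mod_cast h_lt }
  exact ⟨x, y, h_neighbour, rfl, rfl⟩

lemma ordConnected_cutTriangle {r : ℝ} (hr : 0 ≤ r) : (cutTriangle r).OrdConnected where
  out' := by
    rintro p ⟨⟨⟨hp₁, -⟩, hp₂, -⟩, -⟩ q ⟨⟨⟨-, hq₁⟩, -, hq₂⟩, hq⟩ z ⟨⟨hpz₁, hpz₂⟩, hzq₁, hzq₂⟩
    have h_mul : z.1 * z.2 ≤ q.1 * q.2 := by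
      apply mul_le_mul hzq₁ hzq₂ <;> linarith
    exact ⟨⟨⟨by linarith, by linarith⟩, by linarith, by linarith⟩,
      (mul_le_mul_of_nonneg_left h_mul hr).trans_lt hq⟩

/-- The region `cutTriangle r` as a set of vectors indexed by `Fin 2`. -/
def cutTriangleVec (r : ℝ) : Set (Fin 2 → ℝ) := MeasurableEquiv.finTwoArrow ⁻¹' cutTriangle r

lemma tendsto_ncard_primitive_cutTriangle {r : ℝ} (hr : 0 ≤ r) :
    Tendsto (fun N : ℕ =>
        ({x ∈ dilateLatticePoints (cutTriangleVec r) N | content x = 1}.ncard : ℝ) / N ^ 2) atTop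
      (𝓝 (hallTail r / 2 * ∑' d : ℕ, (ArithmeticFunction.moebius d : ℝ) / (d : ℝ) ^ 2)) := by
  have h_volume : volume.real (cutTriangleVec r) = hallTail r / 2 := by
    rw [hallTail, mul_div_cancel_left₀ _ two_ne_zero, measureReal_def, measureReal_def,
      cutTriangleVec, (volume_preserving_finTwoArrow ℝ).measure_preimage_equiv]
  have h_mono : Monotone (MeasurableEquiv.finTwoArrow : (Fin 2 → ℝ) → ℝ × ℝ) :=
    fun _ _ h => ⟨h 0, h 1⟩
  have h_frontier : volume (frontier (cutTriangleVec r)) = 0 :=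
    ((ordConnected_cutTriangle hr).preimage_mono h_mono).null_frontier
  have h_subset : cutTriangleVec r ⊆ Set.Icc 0 1 := by
    rintro z ⟨⟨⟨hz₀, hz₀_le⟩, hz₁, hz₁_le⟩, -⟩
    refine ⟨Pi.le_def.2 (Fin.forall_fin_two.2 ⟨hz₀.le, ?_⟩),
      Pi.le_def.2 (Fin.forall_fin_two.2 ⟨hz₀_le, hz₁_le⟩)⟩
    exact (sub_nonneg.2 hz₀_le).trans hz₁.le
  have h_zero : 0 ∉ cutTriangleVec r := fun h => lt_irrefl _ h.1.1.1
  rw [← h_volume]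
  exact tendsto_ncard_primitive (Fintype.card_fin 2).ge
    ((Metric.isBounded_Icc 0 1).subset h_subset)
    (MeasurableEquiv.finTwoArrow.measurable (measurableSet_cutTriangle r)) h_frontier h_zero

lemma content_eq_one_iff {x : Fin 2 → ℤ} : content x = 1 ↔ IsCoprime (x 0) (x 1) := by
  rw [Int.isCoprime_iff_gcd_eq_one]
  simp [content, Fin.univ_succ, Int.gcd_def, gcd_eq_nat_gcd]

/-- The vector of the denominators of a pair of fractions. -/
def denVec (p : ℚ × ℚ) : Fin 2 → ℤ := ![p.1.den, p.2.den]

lemma injOn_denVec_fareyPairs (N : ℕ) : Set.InjOn denVec (fareyPairs N) := by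
  rintro ⟨x, y⟩ h ⟨x', y'⟩ h' h_den
  have hx : x.den = x'.den := Nat.cast_injective (congrFun h_den 0)
  have hy : y.den = y'.den := Nat.cast_injective (congrFun h_den 1)
  exact Prod.ext_iff.2
    ((mem_fareyPairs_iff.1 h).eq_of_den_eq (mem_fareyPairs_iff.1 h') hx hy)

lemma image_denVec_fareyPairs {N : ℕ} (hN : N ≠ 0) (r : ℝ) :
    denVec '' {p ∈ fareyPairs N | r < (N : ℝ) ^ 2 * ((p.2 : ℝ) - (p.1 : ℝ))} =
      {x ∈ dilateLatticePoints (cutTriangleVec r) N | content x = 1} := by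
  ext v
  constructor
  · rintro ⟨⟨x, y⟩, ⟨h_mem, hr⟩, rfl⟩
    have h := mem_fareyPairs_iff.1 h_mem
    exact ⟨(h.den_div_mem_cutTriangle_iff r).2 hr, content_eq_one_iff.2 h.isCoprime_den⟩
  · rintro ⟨h_cut, h_content⟩
    obtain ⟨x, y, h, hx, hy⟩ := exists_isFareyNeighbour_of_mem hN h_cut.1
      (content_eq_one_iff.1 h_content)
    obtain rfl : denVec (x, y) = v := funext (Fin.forall_fin_two.2 ⟨hx, hy⟩)
    exact ⟨(x, y), ⟨h.mem_fareyPairs, (h.den_div_mem_cutTriangle_iff r).1 h_cut⟩, rfl⟩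

lemma fareyGapTail_eq {N : ℕ} (hN : N ≠ 0) (r : ℝ) :
    fareyGapTail N r =
      ({x ∈ dilateLatticePoints (cutTriangleVec r) N | content x = 1}.ncard : ℝ) /
        ({x ∈ dilateLatticePoints (cutTriangleVec 0) N | content x = 1}.ncard : ℝ) := by
  have h_gap_pos : {p ∈ fareyPairs N | 0 < (N : ℝ) ^ 2 * ((p.2 : ℝ) - (p.1 : ℝ))} =
      fareyPairs N := by
    refine Set.sep_eq_self_iff_mem_true.2 fun p hp => mul_pos ?_ (sub_pos.2 ?_)
    · positivity
    · exact_mod_cast hp.2.2.1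
  rw [fareyGapTail, ← image_denVec_fareyPairs hN, ← image_denVec_fareyPairs hN, h_gap_pos,
    (injOn_denVec_fareyPairs N).ncard_image,
    ((injOn_denVec_fareyPairs N).mono (Set.sep_subset _ _)).ncard_image]

theorem tendsto_fareyGapTail {r : ℝ} (hr : 0 ≤ r) :
    Tendsto (fun N : ℕ => fareyGapTail N r) atTop (𝓝 (hallTail r)) := by
  have h_moebius := tsum_moebius_div_pow_ne_zero le_rfl
  have h_all := tendsto_ncard_primitive_cutTriangle le_rfl
  rw [hallTail_of_le_one zero_le_one] at h_all
  have h_ratio := (tendsto_ncard_primitive_cutTriangle hr).div h_all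
    (mul_ne_zero one_half_pos.ne' h_moebius)
  rw [mul_div_mul_right _ _ h_moebius, div_div_div_cancel_right₀ two_ne_zero, div_one] at h_ratio
  refine h_ratio.congr' ?_
  filter_upwards [eventually_ne_atTop 0] with N hN
  rw [fareyGapTail_eq hN, Pi.div_apply, div_div_div_cancel_right₀ (by positivity)]

end ModularHorocycle

theorem mainTheorem11 :
    (∀ r : ℝ, 0 ≤ r → r < 1 →
      ModularHorocycle.hittingDensity r = 3 / Real.pi ^ 2) ∧
    (∀ r : ℝ, 1 ≤ r → r ≤ 4 →
      ModularHorocycle.hittingDensity r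
        = 3 / Real.pi ^ 2 * (-1 + 2 * r⁻¹ + 2 * r⁻¹ * Real.log r)) ∧
    (∀ r : ℝ, 4 ≤ r →
      ModularHorocycle.hittingDensity r
        = 3 / Real.pi ^ 2 * (-1 + 2 * r⁻¹ + 2 * Real.sqrt (1 / 4 - r⁻¹)
            - 4 * r⁻¹ * Real.log (1 / 2 + Real.sqrt (1 / 4 - r⁻¹)))) ∧
    (ModularHorocycle.hittingDensity ~[atTop] fun r : ℝ => 6 / Real.pi ^ 2 * (r ^ 2)⁻¹) ∧
    (∀ r : ℝ, 0 ≤ r →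
      Tendsto (fun N : ℕ => ModularHorocycle.fareyGapTail N r) atTop
        (𝓝 (Real.pi ^ 2 / 3 * ModularHorocycle.hittingDensity r))) ∧
    (∀ s : ℝ, s ≤ -2 * Real.log 2 →
      ModularHorocycle.extremeDensity s
        = 3 / Real.pi ^ 2 * (-Real.exp (-s) + 2
            + 2 * Real.exp (-s) * Real.sqrt (1 / 4 - Real.exp s)
            - 4 * Real.log (1 / 2 + Real.sqrt (1 / 4 - Real.exp s)))) ∧
    (∀ s : ℝ, -2 * Real.log 2 ≤ s → s ≤ 0 →
      ModularHorocycle.extremeDensity s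
        = 3 / Real.pi ^ 2 * (-Real.exp (-s) + 2 - 2 * s)) ∧
    (∀ s : ℝ, 0 ≤ s →
      ModularHorocycle.extremeDensity s = 3 / Real.pi ^ 2 * Real.exp (-s)) ∧
    (ModularHorocycle.extremeDensity ~[atBot]
      fun s : ℝ => 6 / Real.pi ^ 2 * Real.exp (-|s|)) := by
  have hall_limit (r : ℝ) :
      Real.pi ^ 2 / 3 * ModularHorocycle.hittingDensity r = ModularHorocycle.hallTail r := by
    rw [ModularHorocycle.hittingDensity_eq]
    field_simp
  refine ⟨fun r _ hr => ?_, fun r hr hr' => ?_, fun r hr => ?_,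
    ModularHorocycle.hittingDensity_isEquivalent, fun r hr => ?_,
    fun s => ModularHorocycle.extremeDensity_of_le,
    fun s hs hs' => ModularHorocycle.extremeDensity_of_nonpos hs' hs,
    fun s => ModularHorocycle.extremeDensity_of_nonneg,
    ModularHorocycle.extremeDensity_isEquivalent⟩
  · rw [ModularHorocycle.hittingDensity_eq, ModularHorocycle.hallTail_of_le_one hr.le, mul_one]
  · rw [ModularHorocycle.hittingDensity_eq, ModularHorocycle.hallTail_of_le_four hr hr']
  · rw [ModularHorocycle.hittingDensity_eq, ModularHorocycle.hallTail_of_four_le hr]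
  · rw [hall_limit]
    exact ModularHorocycle.tendsto_fareyGapTail hr
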